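/- All graphs are finite and simple. A graph is \emph{claw-free} if it has no induced subgraph isomorphic to $K_{1,3}$; it is \emph{$k$-connected} if it has more than $k$ vertices and remains connected after the removal of any fewer than $k$ vertices; it is \emph{cubic} if every vertex has degree $3$. Let $\Lambda$ denote the path on three vertices. A \emph{$\Lambda$-factor} of a graph is a spanning subgraph each of whose components is isomorphic to $\Lambda$. A \emph{3-vertex path} in $G$ is a (not necessarily induced) subgraph $L$ of $G$ isomorphic to $\Lambda$; its \emph{centre} is its vertex of degree $2$ in $L$; and $G-L$ is the graph obtained from $G$ by deleting the three vertices of $L$. Let $v(G)$ be the number of vertices of $G$. Let $G$ be a claw-free graph with $v(G)\equiv 0 \pmod 3$. (1) If $G$ is 3-connected and $L$ is a 3-vertex path in $G$ whose centre has degree $3$ in $G$, then $G-L$ is connected and has a $\Lambda$-factor. (2) If $G$ is cubic and 3-connected, or $G$ is 4-connected, then for every 3-vertex path $L$ in $G$ the graph $G-L$ is connected and has a $\Lambda$-factor. -/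

import Mathlib

namespace ClawFreePacking

/-- `G` is `k`-connected: it has more than `k` vertices, and it stays connected whenever fewer than
`k` vertices are removed. -/
def IsKConnected {V : Type*} [Fintype V] (G : SimpleGraph V) (k : ℕ) : Prop :=
  k < Fintype.card V ∧
    ∀ S : Finset V, S.card < k → (G.induce ((S : Set V)ᶜ)).Connected

/-- The claw `K_{1,3}`. -/
abbrev claw : SimpleGraph (Fin 1 ⊕ Fin 3) := completeBipartiteGraph (Fin 1) (Fin 3)

/-- `G` has no induced subgraph isomorphic to a claw. -/
def IsClawFree {V : Type*} (G : SimpleGraph V) : Prop :=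
  ¬ claw.IsIndContained G

/-- The 3-vertex path `Λ`, with vertices `0, 1, 2` and centre `1`. -/
abbrev Lam : SimpleGraph (Fin 3) := SimpleGraph.pathGraph 3

/-- `G` has an `F`-factor: a spanning subgraph `P` (same vertex set, fewer edges) each of whose
components is isomorphic to `F`. -/
def HasFactor {W V : Type*} (F : SimpleGraph W) (G : SimpleGraph V) : Prop :=
  ∃ P : SimpleGraph V, P ≤ G ∧
    ∀ C : P.ConnectedComponent, Nonempty (C.toSimpleGraph ≃g F)

/-- A subgraph `L` of `G` (not necessarily induced) is a 3-vertex path. -/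
def IsThreePath {V : Type*} {G : SimpleGraph V} (L : G.Subgraph) : Prop :=
  Nonempty (Lam ≃g L.coe)

/-- `c` is the centre vertex of the 3-vertex path `L`, i.e. the image of the middle vertex under an
isomorphism from `Λ` to `L`. In particular `L` is a 3-vertex path. -/
def IsThreePathWithCenter {V : Type*} {G : SimpleGraph V} (L : G.Subgraph) (c : V) : Prop :=
  ∃ f : Lam ≃g L.coe, (f 1 : V) = c

/-- `G - L`: the graph obtained from `G` by deleting all vertices of the subgraph `L`. -/
abbrev minus {V : Type*} (G : SimpleGraph V) (L : G.Subgraph) : SimpleGraph ↥(L.vertsᶜ) :=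
  G.induce L.vertsᶜ

end ClawFreePacking

namespace ClawFreePacking

/-! ### Claw-freeness, bounded parts and chains. -/

section chains

variable {V : Type*} {G : SimpleGraph V}

/-! The factor is obtained from a statement about vertex sets that is stable enough for induction. A
chain is a connected set with at most two end-blocks; "end-block" is relaxed to a nonempty part
attached to the rest in at most one vertex, and a chain has no three such parts that are disjoint
and mutually nonadjacent. `Chain.fac` shows that in a claw-free graph every chain of order divisible
by 3 splits into 3-vertex paths. It then suffices that G - L is a chain. Under 4-connectivity
(`NoSep.chain_sdiff`), three end parts would all see a common vertex of L, which is a claw;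
`NoSep.chain_sdiff_path` adapts this to 3-connectivity with a centre of degree 3.

`Chain.fac` uses separators. If a separator vertex has a neighbour on each side, claw-freeness makes
its neighbours on either side a clique, so removing it creates no new end-blocks (`Chain.of_union`).
The two sides therefore remain chains, and the separator can be shared between them so that both
orders become divisible by 3. This settles separators of size 2 and 3 in the absence of smaller
ones. If no set of at most 3 vertices separates, any 3-vertex path can be deleted.

With cut vertices, an innermost side is treated the same way unless it is a single leaf c. Let b be
the neighbour of c. If c is the only other neighbour of b besides some a, the path abc is deleted.
Otherwise b has two further neighbours, one of which, a, is not a cut vertex. Either deleting abc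
leaves a chain, or there is a lobe attached at a and one more vertex e. For a lobe of maximum size
the complement is again a chain (`IsLobe.chain_compl`), and {a, e} serves as a separator to be
shared out. -/

theorem IsClawFree.false_of_triple (hG : IsClawFree G) {c : V} (f : Fin 3 → V)
    (hf : ∀ i, G.Adj c (f i)) (hne : ∀ i j, i ≠ j → f i ≠ f j ∧ ¬ G.Adj (f i) (f j)) : False := by
  refine hG ⟨⟨⟨fun s => Sum.elim (fun _ => c) f s, ?_⟩, ?_⟩⟩
  · rintro (i | i) (j | j) h
    · rw [Subsingleton.elim i j]
    · exact absurd h (hf j).ne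
    · exact absurd h (hf i).ne'
    · by_contra hij
      exact (hne i j (by rintro rfl; exact hij rfl)).1 h
  · intro s t
    change G.Adj (Sum.elim (fun _ => c) f s) (Sum.elim (fun _ => c) f t) ↔ _
    rcases s with i | i <;> rcases t with j | j
    · simp
    · simpa using hf j
    · simpa using (hf i).symm
    · rcases eq_or_ne i j with rfl | h
      · simp
      · simpa using (hne i j h).2

/-- The working form of claw-freeness: a neighbour c of x on one side of a separation forces the
neighbours of x on the other side to form a clique. -/
theorem IsClawFree.adj_of_not_adj (hG : IsClawFree G) {x c u v : V} (hc : G.Adj x c)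
    (hu : G.Adj x u) (hv : G.Adj x v) (huc : ¬ G.Adj u c) (hvc : ¬ G.Adj v c) (hu' : u ≠ c)
    (hv' : v ≠ c) : u = v ∨ G.Adj u v := by
  by_contra h
  push Not at h
  refine hG.false_of_triple (c := x) ![c, u, v] ?_ ?_
  · intro i; fin_cases i <;> simp [hc, hu, hv]
  · intro i j hij
    fin_cases i <;> fin_cases j <;>
      simp_all [G.adj_comm, eq_comm]

/-- All neighbours in `S` of vertices of `X` outside `X` lie in `K`. -/
def Bdd (G : SimpleGraph V) (S X K : Finset V) : Prop :=
  ∀ u ∈ X, ∀ v ∈ S, v ∉ X → G.Adj u v → v ∈ K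

/-- A nonempty subset of `X i` for each `i`, pairwise disjoint and nonadjacent, and each attached
to the rest of `S` in at most one vertex. -/
structure IsTriple (G : SimpleGraph V) (S : Finset V) (X : Fin 3 → Finset V) (b : Fin 3 → V) :
    Prop where
  subset : ∀ i, X i ⊆ S
  nonempty : ∀ i, (X i).Nonempty
  bdd : ∀ i, Bdd G S (X i) {b i}
  sep : ∀ i j, i ≠ j → ∀ u ∈ X i, ∀ v ∈ X j, u ≠ v ∧ ¬ G.Adj u v

/-- The other two parts supply two distinct outside vertices, so one extra vertex never completes a
part to the whole set. This is what turns each part into a genuine separation. -/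
theorem IsTriple.exists_ne {S : Finset V} {X : Fin 3 → Finset V} {b : Fin 3 → V}
    (h : IsTriple G S X b) (i : Fin 3) (z : V) : ∃ y ∈ S, y ∉ X i ∧ y ≠ z := by
  obtain ⟨u, hu⟩ := h.nonempty (i + 1)
  obtain ⟨v, hv⟩ := h.nonempty (i + 2)
  have h1 : i + 1 ≠ i := by fin_cases i <;> decide
  have h2 : i + 2 ≠ i := by fin_cases i <;> decide
  have h3 : i + 1 ≠ i + 2 := by fin_cases i <;> decide
  have huv := (h.sep _ _ h3 u hu v hv).1
  by_cases huz : u = z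
  · exact ⟨v, h.subset _ hv, fun hvi => (h.sep _ _ h2 v hv v hvi).1 rfl,
      fun hvz => huv (huz.trans hvz.symm)⟩
  · exact ⟨u, h.subset _ hu, fun hui => (h.sep _ _ h1 u hu u hui).1 rfl, huz⟩

variable [DecidableEq V]

/-- `S` is not separated by any set of at most `k` vertices. -/
def NoSep (G : SimpleGraph V) (k : ℕ) (S : Finset V) : Prop :=
  ∀ X K : Finset V, X ⊆ S → X.Nonempty → K.card ≤ k → Bdd G S X K → S ⊆ X ∪ K

/-- The induced graph on `S` is connected (or empty) and has at most two end-blocks. -/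
structure Chain (G : SimpleGraph V) (S : Finset V) : Prop where
  conn : NoSep G 0 S
  noTriple : ∀ X b, ¬ IsTriple G S X b

theorem NoSep.mono {S : Finset V} {k l : ℕ} (h : NoSep G k S) (hl : l ≤ k) : NoSep G l S :=
  fun X K h1 h2 h3 h4 => h X K h1 h2 (h3.trans hl) h4

theorem noSep_zero_iff {S : Finset V} :
    NoSep G 0 S ↔ ∀ X, X ⊆ S → X.Nonempty → Bdd G S X ∅ → S ⊆ X := by
  constructor
  · intro h X h1 h2 h3
    simpa using h X ∅ h1 h2 (by simp) h3
  · intro h X K h1 h2 h3 h4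
    obtain rfl : K = ∅ := by simpa using h3
    simpa using h X h1 h2 h4

theorem NoSep.sdiff {S L : Finset V} {k l : ℕ} (h : NoSep G k S) (hl : L.card + l ≤ k) :
    NoSep G l (S \ L) := by
  intro X K h1 h2 h3 h4
  have := h X (K ∪ L) (h1.trans Finset.sdiff_subset) h2
    ((Finset.card_union_le _ _).trans (by omega)) (by
      intro u hu v hv hvX huv
      by_cases hvL : v ∈ L
      · simp [hvL]
      · simp [h4 u hu v (by simp [hv, hvL]) hvX huv])
  intro v hv
  rw [Finset.mem_sdiff] at hv
  have := this hv.1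
  simp only [Finset.mem_union] at this ⊢
  tauto

theorem NoSep.insert_vertex {S : Finset V} {v u : V} (h : NoSep G 0 S) (hu : u ∈ S) (huv : G.Adj v u) :
    NoSep G 0 (insert v S) := by
  rw [noSep_zero_iff] at h ⊢
  intro X hX hne hb
  have key : ∀ w ∈ X, ∀ w' ∈ insert v S, G.Adj w w' → w' ∈ X := by
    intro w hw w' hw' hadj
    by_contra hn
    exact absurd (hb w hw w' hw' hn hadj) (by simp)
  have hne' : (X ∩ S).Nonempty := by
    obtain ⟨w, hw⟩ := hne
    rcases Finset.mem_insert.1 (hX hw) with rfl | hwS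
    · exact ⟨u, by simp [hu, key w hw u (by simp [hu]) huv]⟩
    · exact ⟨w, by simp [hw, hwS]⟩
  have hS := h (X ∩ S) Finset.inter_subset_right hne' (by
    intro w hw w' hw' hn hadj
    simp only [Finset.mem_inter] at hw hn
    exact absurd ⟨key w hw.1 w' (by simp [hw']) hadj, hw'⟩ hn)
  have hS' : S ⊆ X := hS.trans Finset.inter_subset_left
  exact Finset.insert_subset (key u (hS' hu) v (by simp) huv.symm) hS'

/-- Two distinct neighbours prevent the new vertex from being a part on its own, so erasing it from
the parts of a triple keeps them nonempty. -/
theorem Chain.insert_vertex {S : Finset V} {v u u' : V} (h : Chain G S) (hu : u ∈ S) (hu' : u' ∈ S)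
    (hne : u ≠ u') (huv : G.Adj v u) (huv' : G.Adj v u') : Chain G (insert v S) := by
  refine ⟨h.conn.insert_vertex hu huv, fun X b hT => ?_⟩
  by_cases hvS : v ∈ S
  · rw [Finset.insert_eq_of_mem hvS] at hT
    exact h.noTriple X b hT
  have huS : u ∈ insert v S := by simp [hu]
  have huS' : u' ∈ insert v S := by simp [hu']
  refine h.noTriple (fun i => (X i).erase v) b ⟨fun i => ?_, fun i => ?_, fun i => ?_, ?_⟩
  · intro w hw
    have := hT.subset i (Finset.mem_of_mem_erase hw)
    exact (Finset.mem_insert.1 this).resolve_left (Finset.ne_of_mem_erase hw)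
  · by_contra hemp
    rw [Finset.not_nonempty_iff_eq_empty] at hemp
    have hX : ∀ w ∈ X i, w = v := by
      intro w hw
      by_contra hwv
      have : w ∈ (X i).erase v := Finset.mem_erase.2 ⟨hwv, hw⟩
      simp [hemp] at this
    obtain ⟨w, hw⟩ := hT.nonempty i
    obtain rfl := hX w hw
    have h1 := hT.bdd i w hw u huS (fun hm => huv.ne (hX u hm).symm) huv
    have h2 := hT.bdd i w hw u' huS' (fun hm => huv'.ne (hX u' hm).symm) huv'
    simp only [Finset.mem_singleton] at h1 h2
    exact hne (h1.trans h2.symm)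
  · intro w hw w' hw' hn hadj
    refine hT.bdd i w (Finset.mem_of_mem_erase hw) w' (by simp [hw']) (fun hm => hn ?_) hadj
    exact Finset.mem_erase.2 ⟨fun e => hvS (e ▸ hw'), hm⟩
  · intro i j hij w hw w' hw'
    exact hT.sep i j hij w (Finset.mem_of_mem_erase hw) w' (Finset.mem_of_mem_erase hw')

/-! ### Removing a set whose attachments form a clique. -/

section clique
variable {A Y : Finset V}

theorem Bdd.union_right {X K : Finset V} (h : Bdd G A X K)
    (hY : ∀ u ∈ X, ∀ y ∈ Y, ¬ G.Adj u y) : Bdd G (A ∪ Y) X K := by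
  intro u hu v hv hvX huv
  rcases Finset.mem_union.1 hv with hvA | hvY
  · exact h u hu v hvA hvX huv
  · exact absurd huv (hY u hu v hvY)

theorem Bdd.union_union {X K : Finset V} (hX : X ⊆ A) (h : Bdd G A X K)
    (hc : ∀ u ∈ A, ∀ v ∈ A, ∀ y ∈ Y, ∀ z ∈ Y, G.Adj y u → G.Adj z v → u = v ∨ G.Adj u v)
    {x y : V} (hx : x ∈ X) (hy : y ∈ Y) (hxy : G.Adj y x) : Bdd G (A ∪ Y) (X ∪ Y) K := by
  intro u hu v hv hvX huv
  simp only [Finset.mem_union, not_or] at hu hv hvX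
  have hvA : v ∈ A := hv.resolve_right hvX.2
  rcases hu with hu | hu
  · exact h u hu v hvA hvX.1 huv
  · rcases hc x (hX hx) v hvA y hy u hu hxy huv with rfl | h'
    · exact absurd hx hvX.1
    · exact h x hx v hvA hvX.1 h'

theorem NoSep.of_union (h : NoSep G 0 (A ∪ Y)) (hd : Disjoint A Y)
    (hc : ∀ u ∈ A, ∀ v ∈ A, ∀ y ∈ Y, ∀ z ∈ Y, G.Adj y u → G.Adj z v → u = v ∨ G.Adj u v) :
    NoSep G 0 A := by
  rw [noSep_zero_iff] at h ⊢
  intro X hX hne hb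
  by_cases hadj : ∃ x ∈ X, ∃ y ∈ Y, G.Adj y x
  · obtain ⟨x, hx, y, hy, hxy⟩ := hadj
    have := h (X ∪ Y) (Finset.union_subset_union_left hX) (hne.mono Finset.subset_union_left)
      (hb.union_union hX hc hx hy hxy)
    intro v hv
    have hv' := this (Finset.mem_union_left _ hv)
    exact (Finset.mem_union.1 hv').resolve_right (Finset.disjoint_left.1 hd hv)
  · push Not at hadj
    exact Finset.subset_union_left.trans (h X (hX.trans Finset.subset_union_left) hne
      (hb.union_right fun u hu y hy h => hadj u hu y hy h.symm))

/-- The attachments of Y in A form a clique, so at most one part of a triple in A can touch Y.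
Absorbing Y into that part, if there is one, gives a triple in the larger set. -/
theorem Chain.of_union (h : Chain G (A ∪ Y)) (hd : Disjoint A Y)
    (hc : ∀ u ∈ A, ∀ v ∈ A, ∀ y ∈ Y, ∀ z ∈ Y, G.Adj y u → G.Adj z v → u = v ∨ G.Adj u v) :
    Chain G A := by
  refine ⟨h.conn.of_union hd hc, fun X b hT => ?_⟩
  by_cases hadj : ∃ i, ∃ x ∈ X i, ∃ y ∈ Y, G.Adj y x
  · obtain ⟨i, x, hx, y, hy, hxy⟩ := hadj
    have hother : ∀ j, j ≠ i → ∀ u ∈ X j, ∀ z ∈ Y, ¬ G.Adj z u := by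
      intro j hj u hu z hz hzu
      have := hT.sep i j hj.symm x hx u hu
      rcases hc x (hT.subset i hx) u (hT.subset j hu) y hy z hz hxy hzu with h | h
      · exact this.1 h
      · exact this.2 h
    refine h.noTriple (Function.update X i (X i ∪ Y)) b ⟨fun j => ?_, fun j => ?_, fun j => ?_, ?_⟩
    · rcases eq_or_ne j i with rfl | hj
      · simpa using Finset.union_subset_union_left (hT.subset j)
      · simpa [hj] using (hT.subset j).trans Finset.subset_union_left
    · rcases eq_or_ne j i with rfl | hj
      · simpa using (hT.nonempty j).mono Finset.subset_union_left
      · simpa [hj] using hT.nonempty j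
    · rcases eq_or_ne j i with rfl | hj
      · simpa using (hT.bdd j).union_union (hT.subset j) hc hx hy hxy
      · simpa [hj] using (hT.bdd j).union_right fun u hu y hy h => hother j hj u hu y hy h.symm
    · have key : ∀ k, k ≠ i → ∀ u ∈ X i ∪ Y, ∀ v ∈ X k, u ≠ v ∧ ¬ G.Adj u v := by
        intro k hk u hu v hv
        rcases Finset.mem_union.1 hu with hu | hu
        · exact hT.sep i k hk.symm u hu v hv
        · exact ⟨fun e => Finset.disjoint_left.1 hd (hT.subset k hv) (e ▸ hu), hother k hk v hv u hu⟩
      intro j k hjk u hu v hv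
      rcases eq_or_ne j i with rfl | hj
      · simp only [Function.update_self, Function.update_of_ne hjk.symm] at hu hv
        exact key k hjk.symm u hu v hv
      · rcases eq_or_ne k i with rfl | hk
        · simp only [Function.update_self, Function.update_of_ne hj] at hu hv
          have := key j hj v hv u hu
          exact ⟨this.1.symm, fun h => this.2 h.symm⟩
        · simp only [Function.update_of_ne hj, Function.update_of_ne hk] at hu hv
          exact hT.sep j k hjk u hu v hv
  · push Not at hadj
    exact h.noTriple X b ⟨fun i => (hT.subset i).trans Finset.subset_union_left, hT.nonempty,
      fun i => (hT.bdd i).union_right fun u hu y hy h => hadj i u hu y hy h.symm, hT.sep⟩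

end clique

/-- Deleting `L.card` vertices from a set that is `(L.card + 1)`-connected leaves at most two
end-blocks. -/
theorem NoSep.chain_sdiff (hG : IsClawFree G) {S L : Finset V} (hL : L.Nonempty)
    (h : NoSep G L.card S) : Chain G (S \ L) := by
  refine ⟨h.sdiff (by simp), fun X b hT => ?_⟩
  obtain ⟨l, hl⟩ := hL
  -- If l had no neighbour in a part, the rest of L together with the attachment of that part would
  -- separate it with at most `L.card` vertices.
  have key : ∀ i, ∃ u ∈ X i, G.Adj l u := by
    intro i
    by_contra hcon
    push Not at hcon
    obtain ⟨y, hyS, hyX, hyb⟩ := hT.exists_ne i (b i)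
    rw [Finset.mem_sdiff] at hyS
    have := h (X i) (insert (b i) (L.erase l)) ((hT.subset i).trans Finset.sdiff_subset)
      (hT.nonempty i) ((Finset.card_insert_le _ _).trans (by
        rw [Finset.card_erase_of_mem hl]
        have := Finset.card_pos.2 ⟨l, hl⟩
        omega)) (by
      intro u hu v hv hvX huv
      by_cases hvL : v ∈ L
      · refine Finset.mem_insert_of_mem (Finset.mem_erase.2 ⟨?_, hvL⟩)
        rintro rfl
        exact hcon u hu huv.symm
      · have := hT.bdd i u hu v (by simp [hv, hvL]) hvX huv
        simp only [Finset.mem_singleton] at this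
        simp [this])
    have := this hyS.1
    simp [hyX, hyb, hyS.2] at this
  choose f hf hadj using key
  exact hG.false_of_triple f hadj fun i j hij => hT.sep i j hij _ (hf i) _ (hf j)

/-! ### Path partitions and separations. -/

/-- The set `S` can be partitioned into vertex sets of 3-vertex paths of `G`. -/
inductive Fac (G : SimpleGraph V) : Finset V → Prop
  | empty : Fac G ∅
  | path (a b c : V) : G.Adj a b → G.Adj b c → a ≠ c → Fac G {a, b, c}
  | union (S T : Finset V) : Disjoint S T → Fac G S → Fac G T → Fac G (S ∪ T)

/-- A partition of `S` in which `K` separates `A` from `C`. -/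
structure Split (G : SimpleGraph V) (S A C K : Finset V) : Prop where
  union : A ∪ C ∪ K = S
  disj : Disjoint A C
  disjA : Disjoint A K
  disjC : Disjoint C K
  neA : A.Nonempty
  neC : C.Nonempty
  sep : ∀ u ∈ A, ∀ v ∈ C, ¬ G.Adj u v

namespace Split

variable {S A C K : Finset V}

theorem symm (h : Split G S A C K) : Split G S C A K :=
  ⟨by rw [Finset.union_comm C, h.union], h.disj.symm, h.disjC, h.disjA, h.neC, h.neA,
    fun u hu v hv huv => h.sep v hv u hu huv.symm⟩

theorem card (h : Split G S A C K) : S.card = A.card + C.card + K.card := by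
  rw [← h.union, Finset.card_union_of_disjoint (Finset.disjoint_union_left.2 ⟨h.disjA, h.disjC⟩),
    Finset.card_union_of_disjoint h.disj]

theorem subset_left (h : Split G S A C K) : A ⊆ S := by
  rw [← h.union, Finset.union_assoc]; exact Finset.subset_union_left

theorem subset_sep (h : Split G S A C K) : K ⊆ S := by
  rw [← h.union]; exact Finset.subset_union_right

theorem mem_cases (h : Split G S A C K) {v : V} (hv : v ∈ S) : v ∈ A ∨ v ∈ C ∨ v ∈ K := by
  simpa [← h.union, or_assoc] using hv

theorem bdd (h : Split G S A C K) : Bdd G S A K := by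
  intro u hu v hv hvA huv
  rcases h.mem_cases hv with h' | h' | h'
  · exact absurd h' hvA
  · exact absurd huv (h.sep u hu v h')
  · exact h'

/-- A separator of least possible size has no superfluous vertex: one without neighbours in A could
be dropped. -/
theorem exists_adj (h : Split G S A C K) {k : ℕ} (hS : NoSep G k S) (hK : K.card = k + 1) {x : V}
    (hx : x ∈ K) : ∃ u ∈ A, G.Adj x u := by
  by_contra hcon
  push Not at hcon
  obtain ⟨y, hy⟩ := h.neC
  have := hS A (K.erase x) h.subset_left h.neA (by rw [Finset.card_erase_of_mem hx]; omega) (by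
    intro u hu v hv hvA huv
    exact Finset.mem_erase.2 ⟨fun e => hcon u hu (e ▸ huv.symm), h.bdd u hu v hv hvA huv⟩)
    (h.symm.subset_left hy)
  rcases Finset.mem_union.1 this with h' | h'
  · exact Finset.disjoint_left.1 h.disj h' hy
  · exact Finset.disjoint_left.1 h.disjC hy (Finset.mem_of_mem_erase h')

theorem clique (hG : IsClawFree G) (h : Split G S A C K) {x c : V} (hc : c ∈ C) (hxc : G.Adj x c)
    {u v : V} (hu : u ∈ A) (hv : v ∈ A) (hxu : G.Adj x u) (hxv : G.Adj x v) :
    u = v ∨ G.Adj u v :=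
  hG.adj_of_not_adj hxc hxu hxv (h.sep u hu c hc) (h.sep v hv c hc)
    (fun e => Finset.disjoint_left.1 h.disj hu (e ▸ hc))
    (fun e => Finset.disjoint_left.1 h.disj hv (e ▸ hc))

/-- Deleting part of the separator. -/
theorem sdiff (h : Split G S A C K) {L : Finset V} (hL : L ⊆ K) :
    Split G (S \ L) A C (K \ L) := by
  refine ⟨?_, h.disj, h.disjA.mono_right Finset.sdiff_subset, h.disjC.mono_right Finset.sdiff_subset,
    h.neA, h.neC, h.sep⟩
  rw [← h.union, Finset.union_sdiff_distrib, Finset.union_sdiff_distrib,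
    Finset.sdiff_eq_self_of_disjoint (h.disjA.mono_right hL),
    Finset.sdiff_eq_self_of_disjoint (h.disjC.mono_right hL)]

/-- A bounded set gives a partition. -/
theorem of_bdd {X K : Finset V} (hX : X ⊆ S) (hne : X.Nonempty) (hb : Bdd G S X K)
    (h : ¬ S ⊆ X ∪ K) : Split G S X (S \ (X ∪ K)) ((S ∩ K) \ X) := by
  refine ⟨?_, ?_, ?_, ?_, hne, ?_, ?_⟩
  · ext v
    have := @hX v
    simp only [Finset.mem_union, Finset.mem_sdiff, Finset.mem_inter]
    tauto
  · exact Finset.disjoint_left.2 fun v hv hv' => by simp_all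
  · exact Finset.disjoint_left.2 fun v hv hv' => by simp_all
  · exact Finset.disjoint_left.2 fun v hv hv' => by simp_all
  · exact Finset.sdiff_nonempty.2 h
  · intro u hu v hv huv
    simp only [Finset.mem_sdiff, Finset.mem_union, not_or] at hv
    exact hv.2.2 (hb u hu v hv.1 hv.2.1 huv)

end Split

/-- A set that is not separated by `k` but is separated by `k + 1` vertices. -/
theorem NoSep.exists_split {S : Finset V} {k : ℕ} (h : NoSep G k S) (h' : ¬ NoSep G (k + 1) S) :
    ∃ A C K, Split G S A C K ∧ K.card = k + 1 := by
  simp only [NoSep, not_forall] at h'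
  obtain ⟨X, K, hX, hne, hK, hb, hS⟩ := h'
  refine ⟨_, _, _, Split.of_bdd hX hne hb hS, ?_⟩
  have h1 : ((S ∩ K) \ X).card ≤ k + 1 :=
    (Finset.card_le_card (Finset.sdiff_subset.trans Finset.inter_subset_right)).trans hK
  by_contra hne'
  refine hS ?_
  have := h X ((S ∩ K) \ X) hX hne (by omega) (Split.of_bdd hX hne hb hS).bdd
  exact this.trans (Finset.union_subset_union_right
    (Finset.sdiff_subset.trans Finset.inter_subset_right))

/-! ### Sets attached at two vertices. -/

section attached

variable {S P : Finset V} {a e : V}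

/-- A set attached at two vertices, no part of which is attached at a single vertex. -/
theorem chain_insert_of_attached (hb : Bdd G S P {a, e})
    (he : e ∉ P)
    (hZ : ∀ Z, Z ⊆ P → Z.Nonempty → ∀ z, ¬ Bdd G S Z {z})
    (hqe : ∀ u ∈ P, ∀ v ∈ P, G.Adj e u → G.Adj e v → u = v ∨ G.Adj u v) :
    Chain G (P ∪ {a}) := by
  constructor
  · rw [noSep_zero_iff]
    intro X hX hne hXb
    -- The component not containing a can reach the rest of S only through e, which `hZ` forbids.
    by_cases haX : a ∈ X
    · by_contra hsub
      have hne' : (P \ X).Nonempty := by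
        rw [Finset.sdiff_nonempty]
        intro h
        exact hsub (Finset.union_subset h (by simpa using haX))
      refine hZ (P \ X) Finset.sdiff_subset hne' e ?_
      intro u hu v hv hvn huv
      simp only [Finset.mem_sdiff, not_and, not_not] at hu hvn
      have hvX : v ∉ X := fun hvX =>
        absurd (hXb v hvX u (by simp [hu.1]) hu.2 huv.symm) (by simp)
      have hvP : v ∉ P := fun h => hvX (hvn h)
      have := hb u hu.1 v hv hvP huv
      simp only [Finset.mem_insert, Finset.mem_singleton] at this ⊢
      exact this.resolve_left fun h => hvX (h ▸ haX)
    · exfalso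
      have hXP : X ⊆ P := fun v hv => by
        have := hX hv
        simp only [Finset.mem_union, Finset.mem_singleton] at this
        exact this.resolve_right fun h => haX (h ▸ hv)
      refine hZ X hXP hne e ?_
      intro u hu v hv hvX huv
      have hv' : v ∉ P ∪ {a} := fun h => absurd (hXb u hu v h hvX huv) (by simp)
      simp only [Finset.mem_union, Finset.mem_singleton, not_or] at hv'
      have := hb u (hXP hu) v hv hv'.1 huv
      simp only [Finset.mem_insert, Finset.mem_singleton] at this ⊢
      exact this.resolve_left hv'.2
  · intro X b hT
    -- A part avoiding a must touch e. At least two of the three disjoint parts avoid a, and the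
    -- clique at e makes them meet or be adjacent.
    have key : ∀ j, a ∉ X j → X j ⊆ P ∧ ∃ u ∈ X j, G.Adj e u := by
      intro j haj
      have hXP : X j ⊆ P := fun v hv => by
        have := hT.subset j hv
        simp only [Finset.mem_union, Finset.mem_singleton] at this
        exact this.resolve_right fun h => haj (h ▸ hv)
      refine ⟨hXP, ?_⟩
      by_contra hcon
      push Not at hcon
      refine hZ (X j) hXP (hT.nonempty j) (b j) ?_
      intro u hu v hv hvX huv
      refine hT.bdd j u hu v ?_ hvX huv
      by_contra hv'
      simp only [Finset.mem_union, Finset.mem_singleton, not_or] at hv'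
      have := hb u (hXP hu) v hv hv'.1 huv
      simp only [Finset.mem_insert, Finset.mem_singleton] at this
      rcases this with rfl | rfl
      · exact hv'.2 rfl
      · exact hcon u hu huv.symm
    have fin : ∀ j k, j ≠ k → a ∉ X j → a ∉ X k → False := by
      intro j k hjk hj hk
      obtain ⟨hj', u, hu, hu'⟩ := key j hj
      obtain ⟨hk', v, hv, hv'⟩ := key k hk
      have := hT.sep j k hjk u hu v hv
      rcases hqe u (hj' hu) v (hk' hv) hu' hv' with h | h
      · exact this.1 h
      · exact this.2 h
    have ex : ∀ j k, j ≠ k → a ∈ X j → a ∉ X k :=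
      fun j k hjk hj hk => (hT.sep j k hjk a hj a hk).1 rfl
    by_cases h0 : a ∈ X 0
    · exact fin 1 2 (by decide) (ex 0 1 (by decide) h0) (ex 0 2 (by decide) h0)
    · by_cases h1 : a ∈ X 1
      · exact fin 0 2 (by decide) h0 (ex 1 2 (by decide) h1)
      · exact fin 0 1 (by decide) h0 h1

theorem chain_of_attached (hb : Bdd G S P {a, e}) (ha : a ∉ P)
    (he : e ∉ P)
    (hZ : ∀ Z, Z ⊆ P → Z.Nonempty → ∀ z, ¬ Bdd G S Z {z})
    (hqa : ∀ u ∈ P, ∀ v ∈ P, G.Adj a u → G.Adj a v → u = v ∨ G.Adj u v)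
    (hqe : ∀ u ∈ P, ∀ v ∈ P, G.Adj e u → G.Adj e v → u = v ∨ G.Adj u v) :
    Chain G P :=
  (chain_insert_of_attached hb he hZ hqe).of_union (by simpa using ha)
    fun u hu v hv y hy z hz hyu hzv => by
      rw [Finset.mem_singleton] at hy hz
      subst hy hz
      exact hqa u hu v hv hyu hzv

/-- Each part of a triple has to contain a or e, and two vertices cannot serve three disjoint parts.
-/
theorem chain_insert_insert_of_attached (hP : P.Nonempty) (hb : Bdd G S P {a, e})
    (he : e ∉ P)
    (hZ : ∀ Z, Z ⊆ P → Z.Nonempty → ∀ z, ¬ Bdd G S Z {z})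
    (hqe : ∀ u ∈ P, ∀ v ∈ P, G.Adj e u → G.Adj e v → u = v ∨ G.Adj u v) :
    Chain G (P ∪ {a, e}) := by
  have h1 := chain_insert_of_attached hb he hZ hqe
  have heq : P ∪ {a, e} = insert e (P ∪ {a}) := by ext; simp; tauto
  constructor
  · obtain ⟨u, hu, huv⟩ : ∃ u ∈ P, G.Adj e u := by
      by_contra hcon
      push Not at hcon
      refine hZ P subset_rfl hP a ?_
      intro u hu v hv hvP huv
      have := hb u hu v hv hvP huv
      simp only [Finset.mem_insert, Finset.mem_singleton] at this ⊢
      exact this.resolve_right fun h => hcon u hu (h ▸ huv.symm)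
    rw [heq]
    exact h1.conn.insert_vertex (u := u) (by simp [hu]) huv
  · intro X b hT
    have key : ∀ i, a ∈ X i ∨ e ∈ X i := by
      intro i
      by_contra hcon
      push Not at hcon
      have hXP : X i ⊆ P := fun v hv => by
        have := hT.subset i hv
        simp only [Finset.mem_union, Finset.mem_insert, Finset.mem_singleton] at this
        rcases this with h | rfl | rfl
        · exact h
        · exact absurd hv hcon.1
        · exact absurd hv hcon.2
      refine hZ (X i) hXP (hT.nonempty i) (b i) ?_
      intro u hu v hv hvX huv
      refine hT.bdd i u hu v ?_ hvX huv
      by_contra hv'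
      rw [Finset.mem_union, not_or] at hv'
      exact hv'.2 (hb u (hXP hu) v hv hv'.1 huv)
    have ex : ∀ z j k, j ≠ k → z ∈ X j → z ∉ X k :=
      fun z j k hjk hj hk => (hT.sep j k hjk z hj z hk).1 rfl
    have e01 := fun z => ex z 0 1 (by decide)
    have e02 := fun z => ex z 0 2 (by decide)
    have e12 := fun z => ex z 1 2 (by decide)
    rcases key 0 with h0 | h0 <;> rcases key 1 with h1 | h1 <;> rcases key 2 with h2 | h2 <;>
      first
        | exact e01 _ h0 h1
        | exact e02 _ h0 h2
        | exact e12 _ h1 h2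

end attached

/-- Both separator vertices have neighbours in C, so each sees a clique in A. No part of A hangs at
a single vertex, since C and a separator vertex both lie outside it. -/
theorem Split.two_pieces (hG : IsClawFree G) {S A C : Finset V} {x z : V}
    (h : Split G S A C {x, z}) (hxz : x ≠ z) (hS : NoSep G 1 S) :
    Chain G A ∧ Chain G (A ∪ {x}) ∧ Chain G (A ∪ {x, z}) := by
  have hcl : ∀ y ∈ ({x, z} : Finset V), ∀ u ∈ A, ∀ v ∈ A, G.Adj y u → G.Adj y v →
      u = v ∨ G.Adj u v := by
    intro y hy u hu v hv hyu hyv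
    obtain ⟨c, hc, hyc⟩ := h.symm.exists_adj hS (by simp [hxz]) hy
    exact h.clique hG hc hyc hu hv hyu hyv
  have hx := hcl x (by simp)
  have hz := hcl z (by simp)
  have hA := h.disjA
  simp only [Finset.disjoint_insert_right, Finset.disjoint_singleton_right] at hA
  have hZ : ∀ Z, Z ⊆ A → Z.Nonempty → ∀ t, ¬ Bdd G S Z {t} := by
    intro Z hZA hne t hb
    have := hS Z {t} (hZA.trans h.subset_left) hne (by simp) hb
    obtain ⟨c, hc⟩ := h.neC
    have h1 := this (h.symm.subset_left hc)
    have h2 := this (h.subset_sep (by simp : x ∈ _))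
    have hcx : c ≠ x := fun e => Finset.disjoint_left.1 h.disjC hc (by simp [e])
    have h3 : c ∉ Z := fun e => Finset.disjoint_left.1 h.disj (hZA e) hc
    have h4 : x ∉ Z := fun e => hA.1 (hZA e)
    simp only [Finset.mem_union, h3, h4, false_or, Finset.mem_singleton] at h1 h2
    exact hcx (h1.trans h2.symm)
  exact ⟨chain_of_attached h.bdd hA.1 hA.2 hZ hx hz,
    chain_insert_of_attached h.bdd hA.2 hZ hz,
    chain_insert_insert_of_attached h.neA h.bdd hA.2 hZ hz⟩

/-! ### The induction step for sets without cut vertices. -/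

section step

variable {S A C K : Finset V}

/-- Divisibility needs checking on one side only, as the total is divisible by 3. Nonempty sides
make both pieces proper subsets, so the induction applies. -/
theorem Split.fac (ih : ∀ T ⊂ S, Chain G T → 3 ∣ T.card → Fac G T) (hS : 3 ∣ S.card)
    (h : Split G S A C K) (K₁ K₂ : Finset V) (hK : K₁ ∪ K₂ = K) (hd : Disjoint K₁ K₂)
    (h1 : Chain G (A ∪ K₁)) (h2 : Chain G (C ∪ K₂)) (hc : 3 ∣ A.card + K₁.card) : Fac G S := by
  have hA1 : Disjoint A K₁ := h.disjA.mono_right (hK ▸ Finset.subset_union_left)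
  have hA2 : Disjoint A K₂ := h.disjA.mono_right (hK ▸ Finset.subset_union_right)
  have hC1 : Disjoint C K₁ := h.disjC.mono_right (hK ▸ Finset.subset_union_left)
  have hC2 : Disjoint C K₂ := h.disjC.mono_right (hK ▸ Finset.subset_union_right)
  have hdis : Disjoint (A ∪ K₁) (C ∪ K₂) := by
    simp only [Finset.disjoint_union_left, Finset.disjoint_union_right]
    exact ⟨⟨h.disj, hC1.symm⟩, hA2, hd⟩
  have hun : (A ∪ K₁) ∪ (C ∪ K₂) = S := by
    rw [← h.union, ← hK]; ext; simp; tauto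
  have hcard := h.card
  have hcK : K.card = K₁.card + K₂.card := by rw [← hK, Finset.card_union_of_disjoint hd]
  have hpA := Finset.card_pos.2 h.neA
  have hpC := Finset.card_pos.2 h.neC
  have c1 := Finset.card_union_of_disjoint hA1
  have c2 := Finset.card_union_of_disjoint hC2
  rw [← hun]
  refine Fac.union _ _ hdis (ih _ ?_ h1 (by omega)) (ih _ ?_ h2 (by omega))
  · refine Finset.ssubset_iff_subset_ne.2 ⟨hun ▸ Finset.subset_union_left, fun e => ?_⟩
    rw [e] at c1; omega
  · refine Finset.ssubset_iff_subset_ne.2 ⟨hun ▸ Finset.subset_union_right, fun e => ?_⟩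
    rw [e] at c2; omega

/-- The side A takes 0, 1 or 2 separator vertices according to its order modulo 3; every such
distribution leaves two chains. -/
theorem fac_of_two_split (hG : IsClawFree G) (ih : ∀ T ⊂ S, Chain G T → 3 ∣ T.card → Fac G T)
    (hS : 3 ∣ S.card) (hc : NoSep G 1 S) (h : Split G S A C K) (hK : K.card = 2) : Fac G S := by
  obtain ⟨x, z, hxz, rfl⟩ := Finset.card_eq_two.1 hK
  obtain ⟨a0, a1, a2⟩ := h.two_pieces hG hxz hc
  obtain ⟨c0, -, c2⟩ := h.symm.two_pieces hG hxz hc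
  have hcz : Chain G (C ∪ {z}) := by
    have h' := h.symm
    rw [Finset.pair_comm] at h'
    exact (h'.two_pieces hG hxz.symm hc).2.1
  have : A.card % 3 = 0 ∨ A.card % 3 = 1 ∨ A.card % 3 = 2 := by omega
  rcases this with hA | hA | hA
  · exact h.fac ih hS ∅ {x, z} (by simp) (by simp) (by simpa using a0) c2 (by simp; omega)
  · exact h.fac ih hS {x, z} ∅ (by simp) (by simp) a2 (by simpa using c0) (by rw [hK]; omega)
  · exact h.fac ih hS {x} {z} rfl (by simpa using hxz) a1 hcz (by simp; omega)

/-- Here the other side has order 2 modulo 3, so the separator is shared as two and one. Deleting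
the unused separator vertex reduces the chain property of each piece to a 2-separator. -/
theorem fac_of_three_split_one (hG : IsClawFree G)
    (ih : ∀ T ⊂ S, Chain G T → 3 ∣ T.card → Fac G T)
    (hS : 3 ∣ S.card) (hc : NoSep G 2 S) (h : Split G S A C K) (hK : K.card = 3)
    (hA : A.card % 3 = 1) : Fac G S := by
  obtain ⟨p, q, r, hpq, hpr, hqr, rfl⟩ := Finset.card_eq_three.1 hK
  have h1 : Split G (S \ {r}) A C {p, q} := by
    have := h.sdiff (L := {r}) (by simp)
    convert this using 1
    ext v; simp; grind
  have h2 : Split G (S \ {p}) A C {r, q} := by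
    have := h.sdiff (L := {p}) (by simp)
    convert this using 1
    ext v; simp; grind
  have a2 := (h1.two_pieces hG hpq (hc.sdiff (by simp))).2.2
  have c1 := (h2.symm.two_pieces hG hqr.symm (hc.sdiff (by simp))).2.1
  refine h.fac ih hS {p, q} {r} ?_ ?_ a2 c1 ?_
  · ext; simp
  · simp [hpr.symm, hqr.symm]
  · rw [Finset.card_pair hpq]; omega

theorem fac_of_three_split (hG : IsClawFree G)
    (ih : ∀ T ⊂ S, Chain G T → 3 ∣ T.card → Fac G T)
    (hS : 3 ∣ S.card) (hc : NoSep G 2 S) (h : Split G S A C K) (hK : K.card = 3) : Fac G S := by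
  have hcard := h.card
  have : A.card % 3 = 0 ∨ A.card % 3 = 1 ∨ A.card % 3 = 2 := by omega
  rcases this with hA | hA | hA
  -- Both sides now have order 0 modulo 3, so one must take all of K. This works if every separator
  -- vertex has two neighbours in C, by inserting them one at a time.
  · by_cases htwo : ∀ x ∈ K, ∃ u ∈ C, ∃ v ∈ C, u ≠ v ∧ G.Adj x u ∧ G.Adj x v
    · obtain ⟨p, q, r, hpq, hpr, hqr, rfl⟩ := Finset.card_eq_three.1 hK
      have hs : Split G (S \ {r}) A C {p, q} := by
        have := h.sdiff (L := {r}) (by simp)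
        convert this using 1
        ext v; simp; grind
      have a0 := (hs.two_pieces hG hpq (hc.sdiff (by simp))).1
      have c0 := (hs.symm.two_pieces hG hpq (hc.sdiff (by simp))).1
      obtain ⟨u, hu, v, hv, huv, h1, h2⟩ := htwo p (by simp)
      have cp := c0.insert_vertex hu hv huv h1 h2
      obtain ⟨u, hu, v, hv, huv, h1, h2⟩ := htwo q (by simp)
      have cq := cp.insert_vertex (Finset.mem_insert_of_mem hu) (Finset.mem_insert_of_mem hv)
        huv h1 h2
      obtain ⟨u, hu, v, hv, huv, h1, h2⟩ := htwo r (by simp)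
      have cr := cq.insert_vertex (Finset.mem_insert_of_mem (Finset.mem_insert_of_mem hu))
        (Finset.mem_insert_of_mem (Finset.mem_insert_of_mem hv)) huv h1 h2
      refine h.fac ih hS ∅ {p, q, r} (by simp) (by simp) (by simpa using a0) ?_ (by simp; omega)
      convert cr using 1
      ext; simp; tauto
    · push Not at htwo
      obtain ⟨p, hp, hpu⟩ := htwo
      obtain ⟨c, hcC, hpc⟩ := h.symm.exists_adj hc (by omega) hp
      have huniq : ∀ v ∈ C, G.Adj p v → v = c := by
        intro v hv hpv
        by_contra hne
        exact hpu c hcC v hv (fun e => hne e.symm) hpc hpv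
      have hpA : p ∉ A := fun h' => Finset.disjoint_left.1 h.disjA h' hp
      have hpC : p ∉ C := fun h' => Finset.disjoint_left.1 h.disjC h' hp
      have hcK : c ∉ K := fun h' => Finset.disjoint_left.1 h.disjC hcC h'
      have hcA : c ∉ A := fun h' => Finset.disjoint_left.1 h.disj h' hcC
      have hCpos := Finset.card_pos.2 h.neC
      -- Since c is the only neighbour of p in C, it can replace p in the separator. Moving p to A
      -- changes the residue to 1, and C keeps a vertex because its order is a positive multiple of
      -- 3.
      have hs : Split G S (insert p A) (C.erase c) (insert c (K.erase p)) := by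
        have d1 := Finset.disjoint_left.1 h.disj
        have d2 := Finset.disjoint_left.1 h.disjA
        have d3 := Finset.disjoint_left.1 h.disjC
        refine ⟨?_, ?_, ?_, ?_, ⟨p, by simp⟩, ?_, ?_⟩
        · rw [← h.union]
          ext v
          simp only [Finset.mem_union, Finset.mem_insert, Finset.mem_erase]
          grind
        · rw [Finset.disjoint_left]; grind
        · rw [Finset.disjoint_left]; grind
        · rw [Finset.disjoint_left]; grind
        · rw [← Finset.card_pos, Finset.card_erase_of_mem hcC]; omega
        · intro u hu v hv huv
          rw [Finset.mem_erase] at hv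
          rcases Finset.mem_insert.1 hu with rfl | hu
          · exact hv.1 (huniq v hv.2 huv)
          · exact h.sep u hu v hv.2 huv
      refine fac_of_three_split_one hG ih hS hc hs ?_ ?_
      · rw [Finset.card_insert_of_notMem (by simp [hcK]), Finset.card_erase_of_mem hp]; omega
      · rw [Finset.card_insert_of_notMem hpA]; omega
  · exact fac_of_three_split_one hG ih hS hc h hK hA
  · exact fac_of_three_split_one hG ih hS hc h.symm hK (by omega)

theorem NoSep.exists_adj_of_ne {X : Finset V} (h : NoSep G 0 S) (hX : X ⊆ S) (hne : X.Nonempty)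
    (h' : ¬ S ⊆ X) : ∃ u ∈ X, ∃ v ∈ S, v ∉ X ∧ G.Adj u v := by
  by_contra hcon
  push Not at hcon
  exact h' (noSep_zero_iff.1 h X hX hne fun u hu v hv hvX huv => absurd huv (hcon u hu v hv hvX))

/-- A connected set with at least three vertices contains a 3-vertex path. -/
theorem NoSep.exists_path (h : NoSep G 0 S) (hc : 3 ≤ S.card) :
    ∃ a ∈ S, ∃ b ∈ S, ∃ c ∈ S, G.Adj a b ∧ G.Adj b c ∧ a ≠ c := by
  obtain ⟨x, hx⟩ : S.Nonempty := Finset.card_pos.1 (by omega)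
  obtain ⟨u, hu, y, hy, hyx, hxy⟩ := h.exists_adj_of_ne (X := {x}) (by simpa using hx) (by simp)
    (fun hs => by have := Finset.card_le_card hs; simp at this; omega)
  rw [Finset.mem_singleton] at hu hyx
  subst hu
  obtain ⟨w, hw, z, hz, hzn, hwz⟩ := h.exists_adj_of_ne (X := {u, y})
    (by simp [Finset.insert_subset_iff, hx, hy]) (by simp)
    (fun hs => by
      have := (Finset.card_le_card hs).trans Finset.card_le_two
      omega)
  simp only [Finset.mem_insert, Finset.mem_singleton, not_or] at hw hzn
  rcases hw with rfl | rfl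
  · exact ⟨y, hy, w, hx, z, hz, hxy.symm, hwz, fun e => hzn.2 e.symm⟩
  · exact ⟨u, hx, w, hy, z, hz, hxy, hwz, fun e => hzn.1 e.symm⟩

theorem fac_of_path (ih : ∀ T ⊂ S, Chain G T → 3 ∣ T.card → Fac G T) (hS : 3 ∣ S.card)
    {a b c : V} (ha : a ∈ S) (hb : b ∈ S) (hc : c ∈ S) (hab : G.Adj a b) (hbc : G.Adj b c)
    (hac : a ≠ c) (h : Chain G (S \ {a, b, c})) : Fac G S := by
  have hsub : ({a, b, c} : Finset V) ⊆ S := by simp [Finset.insert_subset_iff, ha, hb, hc]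
  have h3 : ({a, b, c} : Finset V).card = 3 := Finset.card_eq_three.2
    ⟨a, b, c, hab.ne, hac, hbc.ne, rfl⟩
  rw [← Finset.union_sdiff_of_subset hsub]
  refine Fac.union _ _ Finset.disjoint_sdiff (Fac.path a b c hab hbc hac) (ih _ ?_ h ?_)
  · exact Finset.sdiff_ssubset hsub ⟨a, by simp⟩
  · rw [Finset.card_sdiff_of_subset hsub, h3]; omega

theorem fac_of_noSep_one (hG : IsClawFree G)
    (ih : ∀ T ⊂ S, Chain G T → 3 ∣ T.card → Fac G T)
    (hS : 3 ∣ S.card) (hc : NoSep G 1 S) : Fac G S := by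
  by_cases h2 : NoSep G 2 S
  · by_cases h3 : NoSep G 3 S
    · rcases S.eq_empty_or_nonempty with rfl | hne
      · exact Fac.empty
      · have := Finset.card_pos.2 hne
        obtain ⟨a, ha, b, hb, c, hc', hab, hbc, hac⟩ :=
          (hc.mono (by omega)).exists_path (by omega : 3 ≤ S.card)
        refine fac_of_path ih hS ha hb hc' hab hbc hac (NoSep.chain_sdiff hG (by simp) ?_)
        rwa [Finset.card_eq_three.2 ⟨a, b, c, hab.ne, hac, hbc.ne, rfl⟩]
    · obtain ⟨A, C, K, h, hK⟩ := h2.exists_split h3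
      exact fac_of_three_split hG ih hS h2 h hK
  · obtain ⟨A, C, K, h, hK⟩ := hc.exists_split h2
    exact fac_of_two_split hG ih hS hc h hK

end step

/-! ### Cut vertices, innermost sides and leaves. -/

section cut

variable {S A C : Finset V} {b : V}

theorem NoSep.exists_cut_of_bdd {X K : Finset V} (h : NoSep G 0 S) (hX : X ⊆ S) (hne : X.Nonempty)
    (hb : Bdd G S X K) (hK : K.card ≤ 1) (hS : ¬ S ⊆ X ∪ K) :
    ∃ A z, Split G S A X {z} ∧ z ∈ K := by
  have hs := Split.of_bdd hX hne hb hS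
  have h1 : ((S ∩ K) \ X).card = 1 := by
    have hle := Finset.card_le_card
      (Finset.sdiff_subset.trans Finset.inter_subset_right : (S ∩ K) \ X ⊆ K)
    by_contra hcon
    have h0 := h X _ hX hne (by omega) hs.bdd
    exact hS (h0.trans (Finset.union_subset_union_right
      (Finset.sdiff_subset.trans Finset.inter_subset_right)))
  obtain ⟨z, hz⟩ := Finset.card_eq_one.1 h1
  have hzK : z ∈ (S ∩ K) \ X := by simp [hz]
  rw [hz] at hs
  simp only [Finset.mem_sdiff, Finset.mem_inter] at hzK
  exact ⟨_, z, hs.symm, hzK.1.2⟩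

theorem Split.clique_of_conn (hG : IsClawFree G) (h : Split G S A C {b}) (hS : NoSep G 0 S)
    {u v : V} (hu : u ∈ A) (hv : v ∈ A) (hbu : G.Adj b u) (hbv : G.Adj b v) :
    u = v ∨ G.Adj u v := by
  obtain ⟨c, hc, hbc⟩ := h.symm.exists_adj hS (by simp) (Finset.mem_singleton_self b)
  exact h.clique hG hc hbc hu hv hbu hbv

/-- The cut vertex sees a clique in A, and is itself the only attachment of C, so either the far
side or the far side with b can be removed. -/
theorem Split.one_pieces (hG : IsClawFree G) (h : Split G S A C {b}) (hS : Chain G S) :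
    Chain G A ∧ Chain G (A ∪ {b}) := by
  have hbA : b ∉ A := by simpa using h.disjA
  have hbC : b ∉ C := by simpa using h.disjC
  constructor
  · refine Chain.of_union (Y := C ∪ {b}) (by rwa [← Finset.union_assoc, h.union])
      (Finset.disjoint_union_right.2 ⟨h.disj, h.disjA⟩) ?_
    have hy : ∀ u ∈ A, ∀ y ∈ C ∪ {b}, G.Adj y u → y = b := by
      intro u hu y hy hyu
      rcases Finset.mem_union.1 hy with hy | hy
      · exact absurd hyu.symm (h.sep u hu y hy)
      · simpa using hy
    intro u hu v hv y hy' z hz' hyu hzv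
    obtain rfl := hy u hu y hy' hyu
    obtain rfl := hy v hv z hz' hzv
    exact h.clique_of_conn hG hS.conn hu hv hyu hzv
  · refine Chain.of_union (Y := C) (by rwa [Finset.union_right_comm, h.union])
      (Finset.disjoint_union_left.2 ⟨h.disj, h.disjC.symm⟩) ?_
    have hy : ∀ u ∈ A ∪ {b}, ∀ y ∈ C, G.Adj y u → u = b := by
      intro u hu y hy hyu
      rcases Finset.mem_union.1 hu with hu | hu
      · exact absurd hyu.symm (h.sep u hu y hy)
      · simpa using hu
    intro u hu v hv y hy' z hz' hyu hzv
    exact Or.inl ((hy u hu y hy' hyu).trans (hy v hv z hz' hzv).symm)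

/-- A minimal side of a cut vertex together with the cut vertex is 2-connected or an edge. -/
theorem Split.noSep_one_of_minimal (h : Split G S A C {b}) (hS : NoSep G 0 S)
    (hmin : ∀ A' C' b', Split G S A' C' {b'} → C' ⊆ C → C ⊆ C') : NoSep G 1 (C ∪ {b}) := by
  have hbC : b ∉ C := by simpa using h.disjC
  have hTS : C ∪ {b} ⊆ S := Finset.union_subset h.symm.subset_left h.subset_sep
  -- A separation inside C is also one of S, with far side X. Minimality forces X to be all of C,
  -- and then b lies in K.
  have key : ∀ X K, X ⊆ C → X.Nonempty → K.card ≤ 1 → Bdd G (C ∪ {b}) X K →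
      C ∪ {b} ⊆ X ∪ K := by
    intro X K hX hne hK hb
    by_contra hcon
    have hbS : Bdd G S X K := by
      intro u hu v hv hvX huv
      refine hb u hu v ?_ hvX huv
      rcases h.mem_cases hv with h' | h' | h'
      · exact absurd huv.symm (h.sep v h' u (hX hu))
      · exact Finset.mem_union_left _ h'
      · exact Finset.mem_union_right _ h'
    obtain ⟨A', z, hs, -⟩ := hS.exists_cut_of_bdd (hX.trans h.symm.subset_left) hne hbS hK
      fun h' => hcon (hTS.trans h')
    have hCX := hmin _ _ _ hs hX
    obtain ⟨c, hc, hbc⟩ := h.symm.exists_adj hS (by simp) (Finset.mem_singleton_self b)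
    have hbK := hb c (hCX hc) b (by simp) (fun h' => hbC (hX h')) hbc.symm
    exact hcon (Finset.union_subset_union hCX (by simpa using hbK))
  intro X K hX hne hK hb
  -- If b is in X, the complementary side avoids b and `key` applies to it instead.
  by_cases hbX : b ∈ X
  · by_contra hcon
    have := key ((C ∪ {b}) \ (X ∪ K)) (K \ X) ?_ (Finset.sdiff_nonempty.2 hcon)
      ((Finset.card_le_card Finset.sdiff_subset).trans hK) ?_
    · have := this (show b ∈ C ∪ {b} by simp)
      simp [hbX] at this
    · intro v hv
      simp only [Finset.mem_sdiff, Finset.mem_union, Finset.mem_singleton, not_or] at hv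
      exact hv.1.resolve_right fun e => hv.2.1 (e ▸ hbX)
    · intro u hu v hv hvn huv
      simp only [Finset.mem_sdiff, Finset.mem_union, not_or] at hu hvn ⊢
      have hvX : v ∉ X := fun hvX => hu.2.2 (hb v hvX u (Finset.mem_union.2 hu.1) hu.2.1 huv.symm)
      refine ⟨?_, hvX⟩
      by_contra hvK
      exact hvn ⟨Finset.mem_union.1 hv, hvX, hvK⟩
  · refine key X K (fun v hv => ?_) hne hK hb
    have := hX hv
    simp only [Finset.mem_union, Finset.mem_singleton] at this
    exact this.resolve_right fun e => hbX (e ▸ hv)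

theorem fac_of_minimal_cut (hG : IsClawFree G)
    (ih : ∀ T ⊂ S, Chain G T → 3 ∣ T.card → Fac G T) (hc : 3 ∣ S.card) (hS : Chain G S)
    (h : Split G S A C {b})
    (hmin : ∀ A' C' b', Split G S A' C' {b'} → C' ⊆ C → C ⊆ C') (hC : C.card ≠ 1) : Fac G S := by
  have hbA : b ∉ A := by simpa using h.disjA
  have hbC : b ∉ C := by simpa using h.disjC
  obtain ⟨a0, a1⟩ := h.one_pieces hG hS
  obtain ⟨c0, c1⟩ := h.symm.one_pieces hG hS
  have hcard := h.card
  simp only [Finset.card_singleton] at hcard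
  have : A.card % 3 = 0 ∨ A.card % 3 = 1 ∨ A.card % 3 = 2 := by omega
  rcases this with hA | hA | hA
  · exact h.fac ih hc ∅ {b} (by simp) (by simp) (by simpa using a0) c1 (by simp; omega)
  -- Now A needs two more vertices: b and a neighbour c of b in C. As C has order 1 modulo 3 and is
  -- not a singleton, something remains of it.
  · obtain ⟨c, hcC, hbc⟩ := h.symm.exists_adj hS.conn (by simp) (Finset.mem_singleton_self b)
    have hCpos := Finset.card_pos.2 h.neC
    have hcA : c ∉ A := fun h' => Finset.disjoint_left.1 h.disj h' hcC
    have d1 := Finset.disjoint_left.1 h.disj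
    have hs : Split G S A (C.erase c) {b, c} := by
      refine ⟨?_, ?_, ?_, ?_, h.neA, ?_, ?_⟩
      · rw [← h.union]; ext v
        simp only [Finset.mem_union, Finset.mem_erase, Finset.mem_insert, Finset.mem_singleton]
        grind
      · exact h.disj.mono_right (Finset.erase_subset _ _)
      · simp [hbA, hcA]
      · simp [hbC]
      · rw [← Finset.card_pos, Finset.card_erase_of_mem hcC]; omega
      · exact fun u hu v hv => h.sep u hu v (Finset.mem_of_mem_erase hv)
    have ch1 : Chain G (A ∪ {b, c}) := by
      refine Chain.of_union (Y := C.erase c) (by rwa [Finset.union_right_comm, hs.union])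
        (Finset.disjoint_union_left.2 ⟨hs.disj, hs.disjC.symm⟩) ?_
      have hy : ∀ u ∈ A ∪ {b, c}, ∀ y ∈ C.erase c, G.Adj y u → u = b ∨ u = c := by
        intro u hu y hy hyu
        rcases Finset.mem_union.1 hu with hu | hu
        · exact absurd hyu.symm (hs.sep u hu y hy)
        · simpa using hu
      intro u hu v hv y hy' z hz' hyu hzv
      rcases hy u hu y hy' hyu with rfl | rfl <;> rcases hy v hv z hz' hzv with rfl | rfl
      · exact Or.inl rfl
      · exact Or.inr hbc
      · exact Or.inr hbc.symm
      · exact Or.inl rfl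
    -- By minimality, C with b has no cut vertex, so deleting c leaves a chain. The vertex b can
    -- then go because its neighbours in C form a clique.
    have ch2 : Chain G (C.erase c) := by
      have h1 := (h.noSep_one_of_minimal hS.conn hmin).chain_sdiff (L := {c}) hG (by simp)
      have heq : (C ∪ {b}) \ {c} = C.erase c ∪ {b} := by
        ext v
        simp only [Finset.mem_sdiff, Finset.mem_union, Finset.mem_singleton, Finset.mem_erase]
        have := hbc.ne
        grind
      rw [heq] at h1
      refine h1.of_union (by simp [hbC]) ?_
      intro u hu v hv y hy z hz hyu hzv
      rw [Finset.mem_singleton] at hy hz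
      subst hy hz
      exact h.symm.clique_of_conn hG hS.conn (Finset.mem_of_mem_erase hu)
        (Finset.mem_of_mem_erase hv) hyu hzv
    exact hs.fac ih hc {b, c} ∅ (by simp) (by simp) ch1 (by simpa using ch2)
      (by rw [Finset.card_pair hbc.ne]; omega)
  · exact h.fac ih hc {b} ∅ (by simp) (by simp) a1 (by simpa using c0) (by simp; omega)

/-- In a counterexample, every side of a cut vertex contains a leaf. -/
theorem exists_leaf_of_not_fac (hG : IsClawFree G)
    (ih : ∀ T ⊂ S, Chain G T → 3 ∣ T.card → Fac G T) (hc : 3 ∣ S.card) (hS : Chain G S)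
    (hF : ¬ Fac G S) (h : Split G S A C {b}) :
    ∃ c ∈ C, ∃ A' b', Split G S A' {c} {b'} := by
  induction C using Finset.strongInduction generalizing A b with
  | H C ihC =>
    by_cases hmin : ∀ A' C' b', Split G S A' C' {b'} → C' ⊆ C → C ⊆ C'
    · have h1 : C.card = 1 := by
        by_contra h1
        exact hF (fac_of_minimal_cut hG ih hc hS h hmin h1)
      obtain ⟨c, rfl⟩ := Finset.card_eq_one.1 h1
      exact ⟨c, by simp, A, b, h⟩
    · push Not at hmin
      obtain ⟨A', C', b', hs, hsub, hn⟩ := hmin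
      obtain ⟨c, hcC, h'⟩ := ihC C' (Finset.ssubset_iff_subset_ne.2
        ⟨hsub, fun e => hn (e ▸ subset_rfl)⟩) hs
      exact ⟨c, hsub hcC, h'⟩

/-- Adjacent leaves would be each other's only neighbours, yet the cut vertex next to a leaf also
has a neighbour on the far side. -/
theorem Split.not_adj_leaf {A' : Finset V} {c w b' : V} (hS : NoSep G 0 S)
    (h : Split G S A {c} {b}) (h' : Split G S A' {w} {b'}) (hcw : c ≠ w) : ¬ G.Adj c w := by
  intro hadj
  have hcS : c ∈ S := h.symm.subset_left (by simp)
  have hwS : w ∈ S := h'.symm.subset_left (by simp)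
  have h1 := h.symm.bdd c (by simp) w hwS (by simpa using hcw.symm) hadj
  have h2 := h'.symm.bdd w (by simp) c hcS (by simpa using hcw) hadj.symm
  simp only [Finset.mem_singleton] at h1 h2
  subst h1 h2
  obtain ⟨u, hu, hwu⟩ := h.exists_adj hS (by simp) (Finset.mem_singleton_self w)
  have h3 := h'.symm.bdd w (by simp) u (h.subset_left hu) (by simpa using hwu.ne') hwu
  simp only [Finset.mem_singleton] at h3
  exact Finset.disjoint_left.1 h.disj hu (by simp [h3])

/-- In a counterexample there are at most two leaves, and each side of a cut contains one. -/
theorem exists_second_leaf (hG : IsClawFree G)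
    (ih : ∀ T ⊂ S, Chain G T → 3 ∣ T.card → Fac G T) (hc : 3 ∣ S.card) (hS : Chain G S)
    (hF : ¬ Fac G S) {c : V} (h : Split G S A {c} {b}) :
    ∃ w, ∀ X, X ⊆ S → X.Nonempty → c ∉ X → w ∉ X → ∀ z, Bdd G S X {z} → S ⊆ X ∪ {z} := by
  have key : ∀ X, X ⊆ S → X.Nonempty → ∀ z, Bdd G S X {z} → ¬ S ⊆ X ∪ {z} →
      ∃ w ∈ X, ∃ A' b', Split G S A' {w} {b'} := by
    intro X hX hne z hb hn
    obtain ⟨A', z', hs, -⟩ := hS.conn.exists_cut_of_bdd hX hne hb (by simp) hn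
    exact exists_leaf_of_not_fac hG ih hc hS hF hs
  by_cases hw : ∃ w, w ≠ c ∧ ∃ A' b', Split G S A' {w} {b'}
  · obtain ⟨w, hwc, A₁, b₁, h₁⟩ := hw
    refine ⟨w, fun X hX hne hcX hwX z hb => ?_⟩
    by_contra hn
    obtain ⟨t, htX, A₂, b₂, h₂⟩ := key X hX hne z hb hn
    have htc : t ≠ c := fun e => hcX (e ▸ htX)
    have htw : t ≠ w := fun e => hwX (e ▸ htX)
    have n1 := h.not_adj_leaf hS.conn h₁ hwc.symm
    have n2 := h.not_adj_leaf hS.conn h₂ htc.symm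
    have n3 := h₁.not_adj_leaf hS.conn h₂ htw.symm
    -- Three leaves are themselves a forbidden triple.
    refine hS.noTriple ![{c}, {w}, {t}] ![b, b₁, b₂] ⟨?_, ?_, ?_, ?_⟩
    · intro i; fin_cases i
      · exact h.symm.subset_left
      · exact h₁.symm.subset_left
      · exact h₂.symm.subset_left
    · intro i; fin_cases i <;> simp
    · intro i; fin_cases i
      · exact h.symm.bdd
      · exact h₁.symm.bdd
      · exact h₂.symm.bdd
    · intro i j hij
      fin_cases i <;> fin_cases j <;> simp_all [G.adj_comm, eq_comm]
  · push Not at hw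
    -- With no second leaf, c serves as a dummy value for w.
    refine ⟨c, fun X hX hne hcX _ z hb => ?_⟩
    by_contra hn
    obtain ⟨t, htX, A₂, b₂, h₂⟩ := key X hX hne z hb hn
    exact hw t (fun e => hcX (e ▸ htX)) A₂ b₂ h₂

end cut

/-! ### Leaf ends and lobes. -/

/-- A leaf `c` of `S` with neighbour `b`, such that every proper part of `S` attached at a single
vertex contains `c` or `w`. -/
structure IsEnd (G : SimpleGraph V) (S : Finset V) (c b w : V) : Prop where
  memc : c ∈ S
  memb : b ∈ S
  adj : G.Adj b c
  leaf : ∀ v ∈ S, G.Adj c v → v = b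
  mem_of_bdd : ∀ X, X ⊆ S → X.Nonempty → c ∉ X → w ∉ X → ∀ z, Bdd G S X {z} → S ⊆ X ∪ {z}

/-- A part of `S`, away from `b`, `c` and `w`, attached at `a` and `e`. -/
structure IsLobe (G : SimpleGraph V) (S : Finset V) (c b w a : V) (P : Finset V) (e : V) :
    Prop where
  subset : P ⊆ S
  nonempty : P.Nonempty
  nota : a ∉ P
  notb : b ∉ P
  notc : c ∉ P
  notw : w ∉ P
  notadj : ∀ u ∈ P, ¬ G.Adj b u
  bdd : Bdd G S P {a, e}

section lobe

variable {S P : Finset V} {a b c w e q : V}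

theorem IsEnd.clique (hG : IsClawFree G) (h : IsEnd G S c b w) {u v : V} (hu : u ∈ S) (hv : v ∈ S)
    (huc : u ≠ c) (hvc : v ≠ c) (hbu : G.Adj b u) (hbv : G.Adj b v) : u = v ∨ G.Adj u v :=
  hG.adj_of_not_adj h.adj hbu hbv (fun h' => hbu.ne' (h.leaf u hu h'.symm))
    (fun h' => hbv.ne' (h.leaf v hv h'.symm)) huc hvc

/-- Both b and c lie outside the lobe, so one vertex cannot cover the remainder of S. -/
theorem IsLobe.not_bdd (h : IsEnd G S c b w) (hP : IsLobe G S c b w a P e) :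
    ∀ Z, Z ⊆ P → Z.Nonempty → ∀ z, ¬ Bdd G S Z {z} := by
  intro Z hZ hne z hb
  have := h.mem_of_bdd Z (hZ.trans hP.subset) hne (fun h' => hP.notc (hZ h'))
    (fun h' => hP.notw (hZ h')) z hb
  have h1 := this h.memb
  have h2 := this h.memc
  have h3 : b ∉ Z := fun h' => hP.notb (hZ h')
  have h4 : c ∉ Z := fun h' => hP.notc (hZ h')
  simp only [Finset.mem_union, h3, h4, false_or, Finset.mem_singleton] at h1 h2
  exact h.adj.ne (h1.trans h2.symm)

theorem IsLobe.exists_adj_left (h : IsEnd G S c b w) (hP : IsLobe G S c b w a P e) :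
    a ∈ S ∧ a ≠ e ∧ ∃ u ∈ P, G.Adj a u := by
  have := hP.not_bdd h P subset_rfl hP.nonempty e
  simp only [Bdd, not_forall] at this
  obtain ⟨u, hu, v, hv, hvP, huv, hn⟩ := this
  have := hP.bdd u hu v hv hvP huv
  simp only [Finset.mem_insert, Finset.mem_singleton] at this hn
  obtain rfl := this.resolve_right hn
  exact ⟨hv, hn, u, hu, huv.symm⟩

theorem IsLobe.exists_adj_right (h : IsEnd G S c b w) (hP : IsLobe G S c b w a P e) :
    e ∈ S ∧ e ∉ P ∧ ∃ u ∈ P, G.Adj e u := by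
  have := hP.not_bdd h P subset_rfl hP.nonempty a
  simp only [Bdd, not_forall] at this
  obtain ⟨u, hu, v, hv, hvP, huv, hn⟩ := this
  have := hP.bdd u hu v hv hvP huv
  simp only [Finset.mem_insert, Finset.mem_singleton] at this hn
  obtain rfl := this.resolve_left hn
  exact ⟨hv, hvP, u, hu, huv.symm⟩

theorem IsLobe.ne_right (h : IsEnd G S c b w) (hP : IsLobe G S c b w a P e) : e ≠ b ∧ e ≠ c := by
  obtain ⟨-, -, u, hu, heu⟩ := hP.exists_adj_right h
  constructor
  · rintro rfl
    exact hP.notadj u hu heu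
  · rintro rfl
    exact hP.notb (h.leaf u (hP.subset hu) heu ▸ hu)

/-- The third neighbour of a that rules out a claw is b, which has no neighbour in the lobe. -/
theorem IsLobe.clique_left (hG : IsClawFree G) (hP : IsLobe G S c b w a P e)
    (hba : G.Adj b a) {u v : V} (hu : u ∈ P) (hv : v ∈ P) (hau : G.Adj a u) (hav : G.Adj a v) :
    u = v ∨ G.Adj u v :=
  hG.adj_of_not_adj hba.symm hau hav (fun h' => hP.notadj u hu h'.symm)
    (fun h' => hP.notadj v hv h'.symm) (fun h' => hP.notb (h' ▸ hu)) (fun h' => hP.notb (h' ▸ hv))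

/-- Because S stays connected without a, the vertex e has a neighbour y outside the lobe and
different from a. No lobe vertex sees y, so claw-freeness at e applies. -/
theorem IsLobe.clique_right (hG : IsClawFree G) (h : IsEnd G S c b w)
    (hP : IsLobe G S c b w a P e) (hba : G.Adj b a) (hconn : NoSep G 0 (S \ {a}))
    {u v : V} (hu : u ∈ P) (hv : v ∈ P) (heu : G.Adj e u) (hev : G.Adj e v) :
    u = v ∨ G.Adj u v := by
  obtain ⟨heS, heP, -⟩ := hP.exists_adj_right h
  obtain ⟨haS, hae, -⟩ := hP.exists_adj_left h
  obtain ⟨heb, hec⟩ := hP.ne_right h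
  obtain ⟨y, hyS, hyP, hya, hey⟩ : ∃ y ∈ S, y ∉ P ∧ y ≠ a ∧ G.Adj e y := by
    by_contra hcon
    push Not at hcon
    have := noSep_zero_iff.1 hconn (insert e P) ?_ (by simp) ?_
    · have := this (show b ∈ S \ {a} by simp [h.memb, hba.ne])
      simp [hP.notb, heb.symm] at this
    · intro v hv
      rcases Finset.mem_insert.1 hv with rfl | hv
      · simp [heS, hae.symm]
      · simp only [Finset.mem_sdiff, Finset.mem_singleton]
        exact ⟨hP.subset hv, fun e => hP.nota (e ▸ hv)⟩
    · intro s hs t ht htn hst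
      exfalso
      simp only [Finset.mem_sdiff, Finset.mem_singleton, Finset.mem_insert, not_or] at ht htn hs
      rcases hs with rfl | hs
      · exact hcon t ht.1 htn.2 ht.2 hst
      · have := hP.bdd s hs t ht.1 htn.2 hst
        simp [ht.2, htn.1] at this
  have hna : ∀ t ∈ P, ¬ G.Adj t y := by
    intro t ht hty
    have := hP.bdd t ht y hyS hyP hty
    simp [hya, hey.ne'] at this
  exact hG.adj_of_not_adj hey heu hev (hna u hu) (hna v hv) (fun h' => hyP (h' ▸ hu))
    (fun h' => hyP (h' ▸ hv))

/-- The complement of a maximal lobe and `a` is a chain. -/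
theorem IsLobe.chain_compl (hG : IsClawFree G) (h : IsEnd G S c b w)
    (hP : IsLobe G S c b w a P e) (hba : G.Adj b a) (hac : a ≠ c) (hconn : NoSep G 0 (S \ {a}))
    (hmax : ∀ P' e', IsLobe G S c b w a P' e' → P'.card ≤ P.card) :
    Chain G (S \ (P ∪ {a})) := by
  obtain ⟨heS, heP, -⟩ := hP.exists_adj_right h
  obtain ⟨haS, hae, p, hp, hap⟩ := hP.exists_adj_left h
  obtain ⟨heb, hec⟩ := hP.ne_right h
  have hmem : ∀ v, v ∈ S \ (P ∪ {a}) ↔ v ∈ S ∧ v ∉ P ∧ v ≠ a := by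
    simp [and_comm]
  have hbR : b ∈ S \ (P ∪ {a}) := (hmem b).2 ⟨h.memb, hP.notb, hba.ne⟩
  have hcR : c ∈ S \ (P ∪ {a}) := (hmem c).2 ⟨h.memc, hP.notc, hac.symm⟩
  have hPe : ∀ u ∈ P, ∀ v ∈ S \ (P ∪ {a}), G.Adj u v → v = e := by
    intro u hu v hv huv
    rw [hmem] at hv
    have := hP.bdd u hu v hv.1 hv.2.1 huv
    simpa [hv.2.2] using this
  -- Otherwise v, b and a lobe neighbour p of a would form a claw centred at a.
  have hna : ∀ v ∈ S \ (P ∪ {a}), G.Adj a v → v ≠ e → v = b ∨ G.Adj b v := by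
    intro v hv hav hve
    by_contra hcon
    push Not at hcon
    have hpb : p ≠ b := fun e => hP.notb (e ▸ hp)
    rcases hG.adj_of_not_adj hap hba.symm hav (fun h' => hP.notadj p hp h')
      (fun h' => hve (hPe p hp v hv h'.symm)) hpb.symm
      (fun e => ((hmem v).1 hv).2.1 (e ▸ hp)) with h' | h'
    · exact hcon.1 h'.symm
    · exact hcon.2 h'
  have hconnR : NoSep G 0 (S \ (P ∪ {a})) := by
    refine NoSep.of_union (Y := P) ?_ (Finset.disjoint_left.2 fun v hv => ((hmem v).1 hv).2.1) ?_
    · convert hconn using 1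
      ext v
      simp only [Finset.mem_union, Finset.mem_sdiff, Finset.mem_singleton]
      have := @hP.subset v
      have : v ∈ P → v ≠ a := fun h1 h2 => hP.nota (h2 ▸ h1)
      tauto
    · intro u hu v hv y hy z hz hyu hzv
      exact Or.inl ((hPe y hy u hu hyu).trans (hPe z hz v hv hzv).symm)
  refine ⟨hconnR, fun X x hT => ?_⟩
  -- a part of the triple that avoids `c` also avoids `b` and its neighbours
  have hfar : ∀ i, c ∉ X i → b ∉ X i ∧ ∀ u ∈ X i, ¬ G.Adj b u := by
    intro i hci
    have hbi : b ∉ X i := by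
      intro hbi
      have hxc : c = x i := by simpa using hT.bdd i b hbi c hcR hci h.adj
      -- The attachment of the part is the leaf c, so adding c closes it off and would exhaust the
      -- set.
      have hsub := noSep_zero_iff.1 hconnR (insert c (X i))
        (Finset.insert_subset hcR (hT.subset i)) (by simp) (by
        intro u hu v hv hvn huv
        exfalso
        simp only [Finset.mem_insert, not_or] at hu hvn
        rcases hu with rfl | hu
        · exact hvn.2 (h.leaf v ((hmem v).1 hv).1 huv ▸ hbi)
        · have := hT.bdd i u hu v hv hvn.2 huv
          simp only [Finset.mem_singleton] at this
          exact hvn.1 (this.trans hxc.symm))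
      obtain ⟨y, hy, hyi, hyx⟩ := hT.exists_ne i (x i)
      have := hsub hy
      simp only [Finset.mem_insert, hyi, or_false] at this
      exact hyx (this.trans hxc)
    refine ⟨hbi, fun u hu hbu => ?_⟩
    have huR := hT.subset i hu
    have hxb : b = x i := by simpa using hT.bdd i u hu b hbR hbi hbu.symm
    -- Now b is the attachment. Its neighbours other than c form a clique, so adding b and c closes
    -- the part off; the other two parts must then be found within the edge bc.
    have hsub := noSep_zero_iff.1 hconnR (insert b (insert c (X i)))
      (Finset.insert_subset hbR (Finset.insert_subset hcR (hT.subset i))) (by simp) (by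
      intro s hs v hv hvn hsv
      exfalso
      simp only [Finset.mem_insert, not_or] at hs hvn
      rcases hs with rfl | rfl | hs
      · have huc : u ≠ c := fun e => hci (e ▸ hu)
        rcases h.clique hG ((hmem u).1 huR).1 ((hmem v).1 hv).1 huc hvn.2.1 hbu hsv with rfl | h'
        · exact hvn.2.2 hu
        · have := hT.bdd i u hu v hv hvn.2.2 h'
          simp only [Finset.mem_singleton] at this
          exact hvn.1 (this.trans hxb.symm)
      · exact hvn.1 (h.leaf v ((hmem v).1 hv).1 hsv)
      · have := hT.bdd i s hs v hv hvn.2.2 hsv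
        simp only [Finset.mem_singleton] at this
        exact hvn.1 (this.trans hxb.symm))
    have hbc : ∀ j, j ≠ i → ∀ t ∈ X j, t = b ∨ t = c := by
      intro j hj t ht
      have := hsub (hT.subset j ht)
      simp only [Finset.mem_insert] at this
      rcases this with h' | h' | h'
      · exact Or.inl h'
      · exact Or.inr h'
      · exact absurd rfl (hT.sep j i hj t ht t h').1
    have h1 : i + 1 ≠ i := by fin_cases i <;> decide
    have h2 : i + 2 ≠ i := by fin_cases i <;> decide
    have h3 : i + 1 ≠ i + 2 := by fin_cases i <;> decide
    obtain ⟨s, hs⟩ := hT.nonempty (i + 1)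
    obtain ⟨t, ht⟩ := hT.nonempty (i + 2)
    have hst := hT.sep _ _ h3 s hs t ht
    rcases hbc _ h1 s hs with rfl | rfl <;> rcases hbc _ h2 t ht with rfl | rfl
    · exact hst.1 rfl
    · exact hst.2 h.adj
    · exact hst.2 h.adj.symm
    · exact hst.1 rfl
  -- A part missing e, c and w gains no attachment from the lobe or from a, so it would hang at a
  -- single vertex in S itself.
  have hcw : ∀ i, e ∉ X i → c ∈ X i ∨ w ∈ X i := by
    intro i hei
    by_contra hcon
    push Not at hcon
    obtain ⟨hbi, hbu⟩ := hfar i hcon.1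
    have hb : Bdd G S (X i) {x i} := by
      intro u hu v hv hvn huv
      have huR := hT.subset i hu
      have hue : u ≠ e := fun e' => hei (e' ▸ hu)
      by_cases hva : v = a
      · subst hva
        rcases hna u huR huv.symm hue with rfl | h'
        · exact absurd hu hbi
        · exact absurd h' (hbu u hu)
      · by_cases hvP : v ∈ P
        · exact absurd (hPe v hvP u huR huv.symm) hue
        · exact hT.bdd i u hu v ((hmem v).2 ⟨hv, hvP, hva⟩) hvn huv
    obtain ⟨y, hy, hyi, hyx⟩ := hT.exists_ne i (x i)
    have := h.mem_of_bdd (X i) ((hT.subset i).trans Finset.sdiff_subset) (hT.nonempty i) hcon.1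
      hcon.2 (x i) hb ((hmem y).1 hy).1
    simp [hyi, hyx] at this
  have ex : ∀ z j k, j ≠ k → z ∈ X j → z ∉ X k :=
    fun z j k hjk hj hk => (hT.sep j k hjk z hj z hk).1 rfl
  -- The two parts avoiding e use up c and w. The remaining part must contain e, and its union with
  -- the lobe is a larger lobe, against maximality.
  have fin : ∀ i j k, i ≠ j → i ≠ k → j ≠ k → e ∉ X j → e ∉ X k → False := by
    intro i j k hij hik hjk hj hk
    have hjcw := hcw j hj
    have hkcw := hcw k hk
    have hci : c ∉ X i := by
      intro hci
      have := ex c i j hij hci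
      have := ex c i k hik hci
      have := ex w j k hjk
      tauto
    have hwi : w ∉ X i := by
      intro hwi
      have := ex w i j hij hwi
      have := ex w i k hik hwi
      have := ex c j k hjk
      tauto
    by_cases hei : e ∈ X i
    · obtain ⟨hbi, hbu⟩ := hfar i hci
      have hl : IsLobe G S c b w a (X i ∪ P) (x i) := by
        refine ⟨Finset.union_subset ((hT.subset i).trans Finset.sdiff_subset) hP.subset,
          (hT.nonempty i).mono Finset.subset_union_left, ?_, by simp [hbi, hP.notb],
          by simp [hci, hP.notc], by simp [hwi, hP.notw], ?_, ?_⟩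
        · have : a ∉ X i := fun h' => ((hmem a).1 (hT.subset i h')).2.2 rfl
          simp [this, hP.nota]
        · intro u hu
          rcases Finset.mem_union.1 hu with hu | hu
          · exact hbu u hu
          · exact hP.notadj u hu
        · intro u hu v hv hvn huv
          simp only [Finset.mem_union, not_or] at hu hvn
          simp only [Finset.mem_insert]
          by_cases hva : v = a
          · exact Or.inl hva
          · right
            have hvR := (hmem v).2 ⟨hv, hvn.2, hva⟩
            rcases hu with hu | hu
            · exact hT.bdd i u hu v hvR hvn.1 huv
            · exact absurd (hPe u hu v hvR huv ▸ hei) hvn.1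
      have h1 := hmax _ _ hl
      have h2 : P ⊂ X i ∪ P := by
        refine Finset.ssubset_iff_subset_ne.2 ⟨Finset.subset_union_right, fun h' => heP ?_⟩
        rw [h']
        exact Finset.mem_union_left _ hei
      have := Finset.card_lt_card h2
      omega
    · rcases hcw i hei with h' | h'
      · exact hci h'
      · exact hwi h'
  by_cases h0 : e ∈ X 0
  · exact fin 0 1 2 (by decide) (by decide) (by decide) (ex e 0 1 (by decide) h0)
      (ex e 0 2 (by decide) h0)
  · by_cases h1 : e ∈ X 1
    · exact fin 1 0 2 (by decide) (by decide) (by decide) h0 (ex e 1 2 (by decide) h1)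
    · exact fin 2 0 1 (by decide) (by decide) (by decide) h0 h1

/-- The pair {a, e} is shared between lobe and complement by residue. Returning a to the complement
needs two neighbours there, b and q, which is why b must have a further neighbour q. -/
theorem IsLobe.fac (hG : IsClawFree G) (ih : ∀ T ⊂ S, Chain G T → 3 ∣ T.card → Fac G T)
    (hS : 3 ∣ S.card) (h : IsEnd G S c b w)
    (hP : IsLobe G S c b w a P e) (hba : G.Adj b a) (hac : a ≠ c) (hconn : NoSep G 0 (S \ {a}))
    (hq : q ∈ S) (hqa : q ≠ a) (hqc : q ≠ c) (hbq : G.Adj b q)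
    (hmax : ∀ P' e', IsLobe G S c b w a P' e' → P'.card ≤ P.card) : Fac G S := by
  obtain ⟨heS, heP, p, hp, hep⟩ := hP.exists_adj_right h
  obtain ⟨haS, hae, -⟩ := hP.exists_adj_left h
  obtain ⟨heb, hec⟩ := hP.ne_right h
  have hR := hP.chain_compl hG h hba hac hconn hmax
  have hl : ∀ u ∈ P, ∀ v ∈ P, G.Adj a u → G.Adj a v → u = v ∨ G.Adj u v :=
    fun u hu v hv => hP.clique_left hG hba hu hv
  have hr : ∀ u ∈ P, ∀ v ∈ P, G.Adj e u → G.Adj e v → u = v ∨ G.Adj u v :=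
    fun u hu v hv => hP.clique_right hG h hba hconn hu hv
  have p0 := chain_of_attached hP.bdd hP.nota heP (hP.not_bdd h) hl hr
  have p1 := chain_insert_of_attached hP.bdd heP (hP.not_bdd h) hr
  have p2 := chain_insert_insert_of_attached hP.nonempty hP.bdd heP (hP.not_bdd h) hr
  have hs : Split G S P (S \ (P ∪ {a, e})) {a, e} := by
    have := Split.of_bdd hP.subset hP.nonempty hP.bdd (fun hsub => by
      have := hsub h.memb
      simp [hP.notb, hba.ne, heb.symm] at this)
    convert this using 1
    ext v
    have : a ∉ P := hP.nota
    simp only [Finset.mem_insert, Finset.mem_singleton, Finset.mem_sdiff, Finset.mem_inter]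
    grind
  have eq1 : S \ (P ∪ {a, e}) ∪ {e} = S \ (P ∪ {a}) := by
    ext v
    simp only [Finset.mem_insert, Finset.mem_singleton, Finset.mem_sdiff, Finset.mem_union]
    grind
  have eq2 : S \ (P ∪ {a, e}) ∪ {a, e} = insert a (S \ (P ∪ {a})) := by
    ext v
    simp only [Finset.mem_insert, Finset.mem_singleton, Finset.mem_sdiff, Finset.mem_union]
    grind
  have r2 : Chain G (S \ (P ∪ {a, e})) := by
    refine Chain.of_union (Y := {e}) (eq1 ▸ hR) (by simp) ?_
    intro u hu v hv y hy z hz hyu hzv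
    rw [Finset.mem_singleton] at hy hz
    subst hy hz
    exact hs.symm.clique hG hp hep hu hv hyu hzv
  have r0 : Chain G (insert a (S \ (P ∪ {a}))) := by
    have haq : G.Adj a q := by
      rcases h.clique hG haS hq hac hqc hba hbq with h' | h'
      · exact absurd h'.symm hqa
      · exact h'
    refine hR.insert_vertex (u := b) (u' := q) ?_ ?_ hbq.ne hba.symm haq
    · simp [h.memb, hP.notb, hba.ne]
    · simp only [Finset.mem_sdiff, Finset.mem_union, Finset.mem_singleton, not_or]
      exact ⟨hq, fun h' => hP.notadj q h' hbq, hqa⟩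
  have hcard : ({a, e} : Finset V).card = 2 := Finset.card_pair hae
  have : P.card % 3 = 0 ∨ P.card % 3 = 1 ∨ P.card % 3 = 2 := by omega
  rcases this with hm | hm | hm
  · exact hs.fac ih hS ∅ {a, e} (by simp) (by simp) (by simpa using p0) (eq2 ▸ r0)
      (by simp; omega)
  · exact hs.fac ih hS {a, e} ∅ (by simp) (by simp) p2 (by simpa using r2) (by rw [hcard]; omega)
  · exact hs.fac ih hS {a} {e} rfl (by simpa using hae) p1 (eq1 ▸ hR) (by simp; omega)

end lobe

/-! ### Resolving a leaf end, and the packing theorem for chains. -/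

section fin

variable {S : Finset V} {a b c w q : V}

theorem exists_side_of_not_noSep (b : V) (hn : ¬ NoSep G 0 (S \ {a})) :
    ∃ U ⊆ S, U.Nonempty ∧ b ∉ U ∧ a ∉ U ∧ Bdd G S U {a} := by
  rw [noSep_zero_iff] at hn
  push Not at hn
  obtain ⟨X, hX, hne, hb, hsub⟩ := hn
  have hclosed : ∀ u ∈ X, ∀ v ∈ S \ {a}, G.Adj u v → v ∈ X := by
    intro u hu v hv huv
    by_contra hvX
    exact absurd (hb u hu v hv hvX huv) (by simp)
  by_cases hbX : b ∈ X
  · refine ⟨(S \ {a}) \ X, Finset.sdiff_subset.trans Finset.sdiff_subset,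
      Finset.sdiff_nonempty.2 hsub, by simp [hbX], by simp, ?_⟩
    intro u hu v hv hvn huv
    rw [Finset.mem_sdiff] at hu
    by_contra hva
    have hv' : v ∈ S \ {a} := by simpa [hv] using hva
    have hvX : v ∈ X := by simpa [Finset.mem_sdiff, hv'] using hvn
    exact hu.2 (hclosed v hvX u hu.1 huv.symm)
  · refine ⟨X, hX.trans Finset.sdiff_subset, hne, hbX, fun h' => by simpa using hX h', ?_⟩
    intro u hu v hv hvn huv
    by_contra hva
    exact hvn (hclosed u hu v (by simpa [hv] using hva) huv)

/-- Of two neighbours of `b` other than the leaf, one is not a cut vertex. -/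
theorem IsEnd.noSep_or (h : IsEnd G S c b w) (hS : NoSep G 0 S)
    (hbq : G.Adj b q) (hba : G.Adj b a) (hqa : q ≠ a) :
    NoSep G 0 (S \ {a}) ∨ NoSep G 0 (S \ {q}) := by
  by_contra hcon
  push Not at hcon
  obtain ⟨U, hU, hUne, hbU, haU, hUb⟩ := exists_side_of_not_noSep b hcon.1
  obtain ⟨W, hW, hWne, hbW, hqW, hWb⟩ := exists_side_of_not_noSep b hcon.2
  have hqU : q ∉ U := fun h' => by
    have := hUb q h' b h.memb hbU hbq.symm
    simp [hba.ne] at this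
  have haW : a ∉ W := fun h' => by
    have := hWb a h' b h.memb hbW hba.symm
    simp [hbq.ne] at this
  -- A side away from b hanging at one vertex cannot contain c, hence contains w. The two sides thus
  -- intersect, and their intersection is closed under adjacency.
  have hw : ∀ U z, U ⊆ S → U.Nonempty → b ∉ U → b ≠ z → Bdd G S U {z} → w ∈ U := by
    intro U z hU hne hb hbz hbd
    by_contra hwU
    have hcU : c ∉ U := fun h' => by
      have := hbd c h' b h.memb hb h.adj.symm
      simp [hbz] at this
    have := h.mem_of_bdd U hU hne hcU hwU z hbd h.memb
    simp [hb, hbz] at this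
  have := noSep_zero_iff.1 hS (U ∩ W) (Finset.inter_subset_left.trans hU)
    ⟨w, Finset.mem_inter.2 ⟨hw U a hU hUne hbU hba.ne hUb, hw W q hW hWne hbW hbq.ne hWb⟩⟩ (by
    intro u hu v hv hvn huv
    exfalso
    rw [Finset.mem_inter] at hu hvn
    have h1 : v ∉ U → v = a := fun h' => by simpa using hUb u hu.1 v hv h' huv
    have h2 : v ∉ W → v = q := fun h' => by simpa using hWb u hu.2 v hv h' huv
    by_cases hvU : v ∈ U
    · exact hqU (h2 (fun h' => hvn ⟨hvU, h'⟩) ▸ hvU)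
    · obtain rfl := h1 hvU
      exact hqa (h2 haW).symm)
  exact hbU (Finset.mem_inter.1 (this h.memb)).1

/-- In a triple left by deleting abc, at most one part contains w, and at most one touches b since
the surviving neighbours of b form a clique. A third part is a lobe. -/
theorem IsEnd.exists_lobe (hG : IsClawFree G) (h : IsEnd G S c b w)
    (hba : G.Adj b a) (hac : a ≠ c) (hconn : NoSep G 0 (S \ {a}))
    (hn : ¬ Chain G (S \ {a, b, c})) : ∃ P e, IsLobe G S c b w a P e := by
  have hmem : ∀ v, v ∈ S \ {a, b, c} ↔ v ∈ S ∧ v ≠ a ∧ v ≠ b ∧ v ≠ c := by simp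
  have hcl : ∀ u ∈ S \ {a, b, c}, ∀ v ∈ S \ {a, b, c}, G.Adj b u → G.Adj b v →
      u = v ∨ G.Adj u v := by
    intro u hu v hv
    rw [hmem] at hu hv
    exact h.clique hG hu.1 hv.1 hu.2.2.2 hv.2.2.2
  have hconn' : NoSep G 0 (S \ {a, b, c}) := by
    refine NoSep.of_union (Y := {b, c}) ?_ ?_ ?_
    · convert hconn using 1
      ext v
      have := h.memb
      have := h.memc
      have := hba.ne
      simp only [Finset.mem_union, Finset.mem_sdiff, Finset.mem_insert, Finset.mem_singleton]
      grind
    · exact Finset.disjoint_left.2 fun v hv => by rw [hmem] at hv; simp [hv.2.2]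
    · have hy : ∀ u ∈ S \ {a, b, c}, ∀ y ∈ ({b, c} : Finset V), G.Adj y u → y = b := by
        intro u hu y hy hyu
        rw [hmem] at hu
        rcases Finset.mem_insert.1 hy with rfl | hy
        · rfl
        · rw [Finset.mem_singleton] at hy
          subst hy
          exact absurd (h.leaf u hu.1 hyu) hu.2.2.1
      intro u hu v hv y hy' z hz' hyu hzv
      obtain rfl := hy u hu y hy' hyu
      obtain rfl := hy v hv z hz' hzv
      exact hcl u hu v hv hyu hzv
  obtain ⟨X, x, hT⟩ : ∃ X x, IsTriple G (S \ {a, b, c}) X x := by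
    by_contra hcon
    push Not at hcon
    exact hn ⟨hconn', hcon⟩
  by_contra hno
  push Not at hno
  have key : ∀ i, w ∈ X i ∨ ∃ u ∈ X i, G.Adj b u := by
    intro i
    by_contra hcon
    push Not at hcon
    have hX := fun u hu => (hmem u).1 (hT.subset i hu)
    refine hno (X i) (x i) ⟨fun u hu => (hX u hu).1, hT.nonempty i,
      fun h' => (hX a h').2.1 rfl, fun h' => (hX b h').2.2.1 rfl, fun h' => (hX c h').2.2.2 rfl,
      hcon.1, hcon.2, ?_⟩
    intro u hu v hv hvn huv
    rw [Finset.mem_insert]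
    by_cases hva : v = a
    · exact Or.inl hva
    · refine Or.inr (hT.bdd i u hu v ((hmem v).2 ⟨hv, hva, ?_, ?_⟩) hvn huv)
      · rintro rfl
        exact hcon.2 u hu huv.symm
      · rintro rfl
        exact (hX u hu).2.2.1 (h.leaf u (hX u hu).1 huv.symm)
  have e1 : ∀ j k, j ≠ k → w ∈ X j → w ∈ X k → False :=
    fun j k hjk hj hk => (hT.sep j k hjk w hj w hk).1 rfl
  have e2 : ∀ j k, j ≠ k → (∃ u ∈ X j, G.Adj b u) → (∃ u ∈ X k, G.Adj b u) → False := by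
    rintro j k hjk ⟨u, hu, hbu⟩ ⟨v, hv, hbv⟩
    have := hT.sep j k hjk u hu v hv
    rcases hcl u (hT.subset j hu) v (hT.subset k hv) hbu hbv with h' | h'
    · exact this.1 h'
    · exact this.2 h'
  rcases key 0 with h0 | h0 <;> rcases key 1 with h1 | h1 <;> rcases key 2 with h2 | h2 <;>
    first
      | exact e1 0 1 (by decide) h0 h1
      | exact e1 0 2 (by decide) h0 h2
      | exact e1 1 2 (by decide) h1 h2
      | exact e2 0 1 (by decide) h0 h1
      | exact e2 0 2 (by decide) h0 h2
      | exact e2 1 2 (by decide) h1 h2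

theorem IsEnd.fac_of_noSep (hG : IsClawFree G) (ih : ∀ T ⊂ S, Chain G T → 3 ∣ T.card → Fac G T)
    (hc : 3 ∣ S.card) (h : IsEnd G S c b w) (ha : a ∈ S)
    (hba : G.Adj b a) (hac : a ≠ c) (hconn : NoSep G 0 (S \ {a}))
    (hq : q ∈ S) (hqa : q ≠ a) (hqc : q ≠ c) (hbq : G.Adj b q) : Fac G S := by
  classical
  by_cases hn : Chain G (S \ {a, b, c})
  · exact fac_of_path ih hc ha h.memb h.memc hba.symm h.adj hac hn
  · obtain ⟨P₀, e₀, hP₀⟩ := h.exists_lobe hG hba hac hconn hn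
    obtain ⟨P, hP, hmax⟩ := (S.powerset.filter fun P => ∃ e, IsLobe G S c b w a P e).exists_max_image
      Finset.card ⟨P₀, by simpa using ⟨hP₀.subset, e₀, hP₀⟩⟩
    rw [Finset.mem_filter] at hP
    obtain ⟨e, hPe⟩ := hP.2
    refine hPe.fac hG ih hc h hba hac hconn hq hqa hqc hbq fun P' e' h' => hmax P' ?_
    simpa using ⟨h'.subset, e', h'⟩

theorem IsEnd.fac (hG : IsClawFree G) (ih : ∀ T ⊂ S, Chain G T → 3 ∣ T.card → Fac G T)
    (hc : 3 ∣ S.card) (h : IsEnd G S c b w) (hS : Chain G S) : Fac G S := by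
  have hbc : ({b, c} : Finset V) ⊆ S := by simp [Finset.insert_subset_iff, h.memb, h.memc]
  obtain ⟨u, hu, a, ha, hab, hua⟩ := hS.conn.exists_adj_of_ne hbc (by simp) (fun h' => by
    have h1 := congrArg Finset.card (hbc.antisymm h')
    rw [Finset.card_pair h.adj.ne] at h1
    omega)
  simp only [Finset.mem_insert, Finset.mem_singleton, not_or] at hu hab
  have hba : G.Adj b a := by
    rcases hu with rfl | rfl
    · exact hua
    · exact absurd (h.leaf a ha hua) hab.1
  -- If b has no neighbours but a and c, the path abc meets the rest only through a, whose other
  -- neighbours form a clique because none of them sees b.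
  by_cases huniq : ∀ q ∈ S, q ≠ c → G.Adj b q → q = a
  · refine fac_of_path ih hc ha h.memb h.memc hba.symm h.adj hab.2 ?_
    have hmem : ∀ v, v ∈ S \ {a, b, c} ↔ v ∈ S ∧ v ≠ a ∧ v ≠ b ∧ v ≠ c := by simp
    have hnb : ∀ u ∈ S \ {a, b, c}, ¬ G.Adj b u := by
      intro u hu hbu
      rw [hmem] at hu
      exact hu.2.1 (huniq u hu.1 hu.2.2.2 hbu)
    refine Chain.of_union (Y := {a, b, c}) ?_ Finset.sdiff_disjoint ?_
    · rwa [Finset.sdiff_union_of_subset (Finset.insert_subset ha hbc)]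
    · have hy : ∀ u ∈ S \ {a, b, c}, ∀ y ∈ ({a, b, c} : Finset V), G.Adj y u → y = a := by
        intro u hu y hy hyu
        simp only [Finset.mem_insert, Finset.mem_singleton] at hy
        rcases hy with rfl | rfl | rfl
        · rfl
        · exact absurd hyu (hnb u hu)
        · rw [hmem] at hu
          exact absurd (h.leaf u hu.1 hyu) hu.2.2.1
      intro u hu v hv y hy' z hz' hyu hzv
      obtain rfl := hy u hu y hy' hyu
      obtain rfl := hy v hv z hz' hzv
      exact hG.adj_of_not_adj hba.symm hyu hzv (fun h' => hnb u hu h'.symm)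
        (fun h' => hnb v hv h'.symm) ((hmem u).1 hu).2.2.1 ((hmem v).1 hv).2.2.1
  · push Not at huniq
    obtain ⟨q, hq, hqc, hbq, hqa⟩ := huniq
    rcases h.noSep_or hS.conn hbq hba hqa with h' | h'
    · exact h.fac_of_noSep hG ih hc ha hba hab.2 h' hq hqa hqc hbq
    · exact h.fac_of_noSep hG ih hc hq hbq hqc h' ha hqa.symm hab.2 hba

end fin

/-- A connected claw-free graph with at most two end-blocks and with `3 * n` vertices can be
partitioned into 3-vertex paths. -/
theorem Chain.fac (hG : IsClawFree G) {S : Finset V} (hS : Chain G S) (hc : 3 ∣ S.card) :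
    Fac G S := by
  induction S using Finset.strongInduction with
  | H S ih' =>
    have ih : ∀ T ⊂ S, Chain G T → 3 ∣ T.card → Fac G T := fun T hT h h' => ih' T hT h h'
    by_cases h1 : NoSep G 1 S
    · exact fac_of_noSep_one hG ih hc h1
    · by_contra hF
      obtain ⟨A, C, K, h, hK⟩ := hS.conn.exists_split h1
      obtain ⟨b, rfl⟩ := Finset.card_eq_one.1 hK
      obtain ⟨c, -, A', b', h'⟩ := exists_leaf_of_not_fac hG ih hc hS hF h
      obtain ⟨w, hw⟩ := exists_second_leaf hG ih hc hS hF h'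
      obtain ⟨u, hu, hadj⟩ := h'.symm.exists_adj hS.conn (by simp) (Finset.mem_singleton_self b')
      rw [Finset.mem_singleton] at hu
      subst hu
      have hend : IsEnd G S u b' w := by
        refine ⟨h'.symm.subset_left (by simp), h'.subset_sep (by simp), hadj, fun v hv huv => ?_, hw⟩
        simpa using h'.symm.bdd u (by simp) v hv (by simpa using huv.ne') huv
      exact hF (hend.fac hG ih hc hS)

/-- A vertex partition into 3-vertex paths, as a graph. -/
theorem Fac.exists_graph {S : Finset V} (h : Fac G S) :
    ∃ P : SimpleGraph V, P ≤ G ∧ (∀ u v, P.Adj u v → u ∈ S) ∧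
      ∀ v ∈ S, ∃ f : Fin 3 → V, Function.Injective f ∧ v ∈ Set.range f ∧ (∀ i, f i ∈ S) ∧
        ∀ i u, P.Adj (f i) u ↔ ∃ j, u = f j ∧ Lam.Adj i j := by
  induction h with
  | empty => exact ⟨⊥, bot_le, by simp, by simp⟩
  | path a b c hab hbc hac =>
    have hinj : Function.Injective ![a, b, c] := by
      intro i j hij
      have h1 := hab.ne
      have h2 := hbc.ne
      fin_cases i <;> fin_cases j <;> simp_all [eq_comm]
    have hmem : ∀ i, ![a, b, c] i ∈ ({a, b, c} : Finset V) := by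
      intro i; fin_cases i <;> simp
    refine ⟨Lam.map (⟨![a, b, c], hinj⟩ : Fin 3 ↪ V), ?_, ?_, ?_⟩
    · rw [SimpleGraph.map_le_iff_le_comap]
      intro i j hij
      rw [SimpleGraph.pathGraph_adj] at hij
      fin_cases i <;> fin_cases j <;> simp_all [G.adj_comm]
    · intro u v huv
      rw [SimpleGraph.map_adj] at huv
      obtain ⟨i, j, -, rfl, -⟩ := huv
      exact hmem i
    · intro v hv
      refine ⟨![a, b, c], hinj, ?_, hmem, ?_⟩
      · simp only [Finset.mem_insert, Finset.mem_singleton] at hv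
        rcases hv with rfl | rfl | rfl
        · exact ⟨0, rfl⟩
        · exact ⟨1, rfl⟩
        · exact ⟨2, rfl⟩
      · intro i u
        rw [SimpleGraph.map_adj]
        constructor
        · rintro ⟨i', j, hij, hi, rfl⟩
          obtain rfl : i' = i := hinj hi
          exact ⟨j, rfl, hij⟩
        · rintro ⟨j, rfl, hij⟩
          exact ⟨i, j, hij, rfl, rfl⟩
  | union S T hd _ _ ihS ihT =>
    obtain ⟨P, hP, hPS, hPf⟩ := ihS
    obtain ⟨Q, hQ, hQT, hQf⟩ := ihT
    have hd' := Finset.disjoint_left.1 hd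
    refine ⟨P ⊔ Q, sup_le hP hQ, ?_, ?_⟩
    · rintro u v (h | h)
      · exact Finset.mem_union_left _ (hPS u v h)
      · exact Finset.mem_union_right _ (hQT u v h)
    · intro v hv
      rcases Finset.mem_union.1 hv with hv | hv
      · obtain ⟨f, h1, h2, h3, h4⟩ := hPf v hv
        refine ⟨f, h1, h2, fun i => Finset.mem_union_left _ (h3 i), fun i u => ?_⟩
        rw [← h4, SimpleGraph.sup_adj]
        exact or_iff_left fun h => hd' (h3 i) (hQT _ _ h)
      · obtain ⟨f, h1, h2, h3, h4⟩ := hQf v hv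
        refine ⟨f, h1, h2, fun i => Finset.mem_union_right _ (h3 i), fun i u => ?_⟩
        rw [← h4, SimpleGraph.sup_adj]
        exact or_iff_right fun h => hd' (hPS _ _ h) (h3 i)

end chains

/-! ### Translation to graphs, connectivity and subgraphs. -/

section interface

variable {V : Type*} {G : SimpleGraph V}

/-- The image of f is connected and closed under adjacency, so it is exactly the component. -/
theorem nonempty_iso_of_adj_iff {P : SimpleGraph V} (C : P.ConnectedComponent) (f : Fin 3 → V)
    (hf : Function.Injective f) {v : V} (hv : v ∈ C.supp) (hvf : v ∈ Set.range f)
    (hadj : ∀ i u, P.Adj (f i) u ↔ ∃ j, u = f j ∧ Lam.Adj i j) :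
    Nonempty (C.toSimpleGraph ≃g Lam) := by
  have hcl : ∀ u ∈ Set.range f, ∀ w, P.Adj u w → w ∈ Set.range f := by
    rintro _ ⟨i, rfl⟩ w h
    obtain ⟨j, rfl, -⟩ := (hadj i w).1 h
    exact ⟨j, rfl⟩
  have hreach : ∀ u w, P.Reachable u w → u ∈ Set.range f → w ∈ Set.range f := by
    rintro u w ⟨p⟩ hu
    induction p with
    | nil => exact hu
    | cons h p ih => exact ih (hcl _ hu _ h)
  have hstep : ∀ i j, Lam.Adj i j → P.Reachable (f i) (f j) := fun i j hij =>
    ((hadj i (f j)).2 ⟨j, rfl, hij⟩).reachable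
  have hconn : ∀ i j, P.Reachable (f i) (f j) := by
    intro i j
    obtain ⟨p⟩ := (SimpleGraph.pathGraph_connected 2).preconnected i j
    induction p with
    | nil => exact SimpleGraph.Reachable.refl _
    | cons h p ih => exact (hstep _ _ h).trans ih
  obtain ⟨k, rfl⟩ := hvf
  have hsupp : ∀ i, f i ∈ C.supp := by
    intro i
    rw [SimpleGraph.ConnectedComponent.mem_supp_iff] at hv ⊢
    rw [← hv]
    exact SimpleGraph.ConnectedComponent.sound (hconn i k)
  have hrange : ∀ w ∈ C.supp, w ∈ Set.range f := by
    intro w hw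
    rw [SimpleGraph.ConnectedComponent.mem_supp_iff] at hv hw
    exact hreach (f k) w (SimpleGraph.ConnectedComponent.exact (hv.trans hw.symm)) ⟨k, rfl⟩
  let g : Fin 3 → C := fun i => ⟨f i, hsupp i⟩
  have hg : Function.Bijective g := by
    constructor
    · intro i j hij
      exact hf (congrArg Subtype.val hij)
    · rintro ⟨w, hw⟩
      obtain ⟨i, rfl⟩ := hrange w hw
      exact ⟨i, rfl⟩
  refine ⟨SimpleGraph.Iso.symm ⟨Equiv.ofBijective g hg, ?_⟩⟩
  intro i j
  change P.Adj (f i) (f j) ↔ _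
  rw [hadj]
  constructor
  · rintro ⟨j', hj, h⟩
    rwa [hf hj]
  · exact fun h => ⟨j, rfl, h⟩

theorem NoSep.induce_connected [DecidableEq V] {S : Finset V} {s : Set V} (hs : ∀ v, v ∈ s ↔ v ∈ S)
    (h : NoSep G 0 S) (hne : S.Nonempty) : (G.induce s).Connected := by
  classical
  obtain ⟨x, hx⟩ := hne
  have hx' : x ∈ s := (hs x).2 hx
  rw [SimpleGraph.connected_iff_exists_forall_reachable]
  refine ⟨⟨x, hx'⟩, ?_⟩
  have hsub := noSep_zero_iff.1 h
    (S.filter fun v => ∃ hv : v ∈ s, (G.induce s).Reachable ⟨x, hx'⟩ ⟨v, hv⟩)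
    (Finset.filter_subset _ _)
    ⟨x, Finset.mem_filter.2 ⟨hx, hx', SimpleGraph.Reachable.refl _⟩⟩ (by
    intro u hu v hv hvn huv
    refine absurd (Finset.mem_filter.2 ⟨hv, (hs v).2 hv, ?_⟩) hvn
    obtain ⟨-, hus, hr⟩ := Finset.mem_filter.1 hu
    have : (G.induce s).Adj ⟨u, hus⟩ ⟨v, (hs v).2 hv⟩ := huv
    exact hr.trans this.reachable)
  rintro ⟨v, hv⟩
  exact (Finset.mem_filter.1 (hsub ((hs v).1 hv))).2.2

theorem Fac.hasFactor {S : Finset V} {s : Set V} (hs : ∀ v, v ∈ s ↔ v ∈ S)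
    [DecidableEq V] (h : Fac G S) : HasFactor Lam (G.induce s) := by
  obtain ⟨P, hP, -, hf⟩ := h.exists_graph
  refine ⟨P.induce s, fun u v huv => hP huv, fun C => ?_⟩
  obtain ⟨⟨v, hv⟩, hvC⟩ := C.nonempty_supp
  obtain ⟨f, h1, ⟨i, hi⟩, h3, h4⟩ := hf v ((hs v).1 hv)
  refine nonempty_iso_of_adj_iff C (fun i => ⟨f i, (hs _).2 (h3 i)⟩)
    (fun i j hij => h1 (congrArg Subtype.val hij)) hvC ⟨i, Subtype.ext hi⟩ ?_
  rintro i ⟨u, hu⟩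
  change P.Adj (f i) u ↔ _
  simp [h4]

theorem IsKConnected.noSep [Fintype V] [DecidableEq V] {k : ℕ} (h : IsKConnected G (k + 1)) :
    NoSep G k Finset.univ := by
  intro X K _ hne hK hb y _
  by_contra hy
  rw [Finset.mem_union, not_or] at hy
  obtain ⟨x, hx⟩ := hne
  -- Only K outside X is deleted, so that the chosen vertex of X survives; a walk leaving X would
  -- have to enter K.
  have hc := h.2 (K \ X) (Nat.lt_succ_of_le ((Finset.card_le_card Finset.sdiff_subset).trans hK))
  have hxm : x ∈ (((K \ X : Finset V) : Set V)ᶜ) := by simp [hx]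
  have hym : y ∈ (((K \ X : Finset V) : Set V)ᶜ) := by simp [hy.2]
  obtain ⟨p⟩ := hc.preconnected ⟨x, hxm⟩ ⟨y, hym⟩
  have : ∀ u v : (((K \ X : Finset V) : Set V)ᶜ : Set V),
      (G.induce (((K \ X : Finset V) : Set V)ᶜ)).Walk u v → (u : V) ∈ X → (v : V) ∈ X := by
    intro u v p hu
    induction p with
    | nil => exact hu
    | @cons u v w huv p ih =>
      refine ih ?_
      by_contra hvX
      have hvK := hb u hu v (Finset.mem_univ _) hvX huv
      exact v.2 (by simp [hvX, hvK])
  exact hy.1 (this _ _ p hx)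

/-- Deleting a 3-vertex path with centre of degree at most three. -/
theorem NoSep.chain_sdiff_path [Fintype V] [DecidableEq V] (hG : IsClawFree G)
    (h : NoSep G 2 Finset.univ) {a b c d : V} (hc : ∀ v, G.Adj c v → v = a ∨ v = b ∨ v = d) :
    Chain G (Finset.univ \ {a, c, b}) := by
  have hmem : ∀ v, v ∈ (Finset.univ \ {a, c, b} : Finset V) ↔ v ≠ a ∧ v ≠ c ∧ v ≠ b := by simp
  have hcd : ∀ X, X ⊆ Finset.univ \ {a, c, b} → ∀ u ∈ X, G.Adj c u → d ∈ X := by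
    intro X hX u hu hcu
    have := (hmem u).1 (hX hu)
    rcases hc u hcu with h' | h' | h'
    · exact absurd h' this.1
    · exact absurd h' this.2.2
    · exact h' ▸ hu
  constructor
  -- A closed proper part without d has no contact with c, so {a, b} would separate it. Both the
  -- part and its complement would therefore contain d.
  · have key : ∀ X, X ⊆ Finset.univ \ {a, c, b} → X.Nonempty →
        Bdd G (Finset.univ \ {a, c, b}) X ∅ → ¬ Finset.univ \ {a, c, b} ⊆ X → d ∈ X := by
      intro X hX hne hb hn
      by_contra hd
      refine hn fun v hv => ?_
      have := h X {a, b} (Finset.subset_univ _) hne Finset.card_le_two (by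
        intro u hu v _ hvn huv
        by_contra hvn'
        simp only [Finset.mem_insert, Finset.mem_singleton, not_or] at hvn'
        by_cases hvc : v = c
        · subst hvc
          exact hd (hcd X hX u hu huv.symm)
        · exact absurd (hb u hu v ((hmem v).2 ⟨hvn'.1, hvc, hvn'.2⟩) hvn huv) (by simp))
        (Finset.mem_univ v)
      have hv' := (hmem v).1 hv
      simpa [hv'.1, hv'.2.2] using this
    rw [noSep_zero_iff]
    intro X hX hne hb
    by_contra hn
    have h1 := key X hX hne hb hn
    have h2 := key ((Finset.univ \ {a, c, b}) \ X) Finset.sdiff_subset (Finset.sdiff_nonempty.2 hn)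
      (by
        intro u hu v hv hvn huv
        rw [Finset.mem_sdiff] at hu
        have hvX : v ∈ X := by
          by_contra hvX
          exact hvn (Finset.mem_sdiff.2 ⟨hv, hvX⟩)
        exact absurd (hb v hvX u hu.1 hu.2 huv.symm) (by simp))
      (by
        obtain ⟨x, hx⟩ := hne
        exact fun h' => (Finset.mem_sdiff.1 (h' (hX hx))).2 hx)
    exact (Finset.mem_sdiff.1 h2).2 h1
  · intro X x hT
    -- Otherwise at most one path vertex z sees the part, and z together with the attachment of the
    -- part is a separator of size at most two.
    have key : ∀ i p q, (p = a ∧ q = b ∨ p = b ∧ q = a) → (∀ u ∈ X i, ¬ G.Adj p u) →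
        d ∈ X i ∧ ∃ u ∈ X i, G.Adj q u := by
      intro i p q hpq hp
      by_contra hcon
      obtain ⟨z, hzm, hz⟩ : ∃ z, (z = a ∨ z = b ∨ z = c) ∧ ∀ v, (∃ u ∈ X i, G.Adj u v) → v = a ∨ v = b ∨ v = c → v = z := by
        by_cases hd : d ∈ X i
        · refine ⟨c, by simp, ?_⟩
          rintro v ⟨u, hu, huv⟩ hv
          have h1 : v ≠ p := fun e => hp u hu (e ▸ huv.symm)
          have h2 : v ≠ q := fun e => hcon ⟨hd, u, hu, e ▸ huv.symm⟩
          grind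
        · refine ⟨q, by tauto, ?_⟩
          rintro v ⟨u, hu, huv⟩ hv
          have h1 : v ≠ p := fun e => hp u hu (e ▸ huv.symm)
          have h2 : v ≠ c := fun e => hd (hcd _ (hT.subset i) u hu (e ▸ huv.symm))
          grind
      obtain ⟨y, hyS, hyX, hyx⟩ := hT.exists_ne i (x i)
      have hb : Bdd G Finset.univ (X i) {z, x i} := by
        intro u hu v _ hvn huv
        by_cases hv : v = a ∨ v = b ∨ v = c
        · simp [hz v ⟨u, hu, huv⟩ hv]
        · have := hT.bdd i u hu v ((hmem v).2 (by tauto)) hvn huv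
          simp only [Finset.mem_singleton] at this
          simp [this]
      have hy := h (X i) {z, x i} (Finset.subset_univ _) (hT.nonempty i) Finset.card_le_two hb
        (Finset.mem_univ y)
      simp only [Finset.mem_union, Finset.mem_insert, Finset.mem_singleton, hyX, hyx, false_or,
        or_false] at hy
      have := (hmem y).1 hyS
      subst hy
      tauto
    have ex : ∀ j k, j ≠ k → d ∈ X j → d ∉ X k :=
      fun j k hjk hj hk => (hT.sep j k hjk d hj d hk).1 rfl
    have claw : ∀ p, ¬ ∀ i, ∃ u ∈ X i, G.Adj p u := by
      intro p hp
      choose f hf hadj using hp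
      exact hG.false_of_triple f hadj fun i j hij => hT.sep i j hij _ (hf i) _ (hf j)
    -- Each of a and b misses some part, and every missed part contains d. So both miss the same
    -- part, although a part missed by a must touch b.
    have ha := claw a
    have hb := claw b
    push Not at ha hb
    obtain ⟨i, hi⟩ := ha
    obtain ⟨j, hj⟩ := hb
    obtain ⟨hdi, u, hu, hbu⟩ := key i a b (Or.inl ⟨rfl, rfl⟩) hi
    obtain ⟨hdj, -⟩ := key j b a (Or.inr ⟨rfl, rfl⟩) hj
    by_cases hij : i = j
    · subst hij
      exact hj u hu hbu
    · exact ex i j hij hdi hdj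

theorem IsThreePathWithCenter.exists_verts {L : G.Subgraph} {c : V}
    (h : IsThreePathWithCenter L c) :
    ∃ a b, G.Adj a c ∧ G.Adj c b ∧ a ≠ b ∧ L.verts = {a, c, b} := by
  obtain ⟨f, rfl⟩ := h
  have h01 : L.coe.Adj (f 0) (f 1) := f.map_adj_iff.2 (by simp [SimpleGraph.pathGraph_adj])
  have h12 : L.coe.Adj (f 1) (f 2) := f.map_adj_iff.2 (by simp [SimpleGraph.pathGraph_adj])
  refine ⟨f 0, f 2, L.adj_sub h01, L.adj_sub h12, fun e => ?_, ?_⟩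
  · exact absurd (f.injective (Subtype.ext e)) (by decide)
  · ext v
    constructor
    · intro hv
      obtain ⟨i, hi⟩ := f.surjective ⟨v, hv⟩
      have hi' : (f i : V) = v := congrArg Subtype.val hi
      rw [← hi']
      fin_cases i <;> simp
    · rintro (rfl | rfl | rfl) <;> exact Subtype.prop _

theorem connected_and_hasFactor_of_chain [Fintype V] [DecidableEq V] (hG : IsClawFree G)
    (hmod : Fintype.card V ≡ 0 [MOD 3]) (hV : 3 < Fintype.card V) {L : G.Subgraph} {a b c : V}
    (hac : a ≠ c) (hcb : c ≠ b) (hab : a ≠ b) (hL : L.verts = {a, c, b})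
    (h : Chain G (Finset.univ \ {a, c, b})) :
    (minus G L).Connected ∧ HasFactor Lam (minus G L) := by
  have hs : ∀ v, v ∈ L.vertsᶜ ↔ v ∈ (Finset.univ \ {a, c, b} : Finset V) := by
    intro v; simp [hL]
  have h3 : ({a, c, b} : Finset V).card = 3 := Finset.card_eq_three.2 ⟨a, c, b, hac, hab, hcb, rfl⟩
  have hcard : (Finset.univ \ {a, c, b} : Finset V).card = Fintype.card V - 3 := by
    rw [Finset.card_sdiff_of_subset (Finset.subset_univ _), h3, Finset.card_univ]
  have hdvd : 3 ∣ Fintype.card V := (Nat.modEq_zero_iff_dvd).1 hmod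
  refine ⟨h.conn.induce_connected hs (Finset.card_pos.1 (by omega)),
    (h.fac hG (by omega)).hasFactor hs⟩

theorem exists_third_of_degree_eq_three [Fintype V] [DecidableRel G.Adj] {a b c : V}
    (hd : G.degree c = 3) (hca : G.Adj c a) (hcb : G.Adj c b) (hab : a ≠ b) :
    ∃ d, ∀ v, G.Adj c v → v = a ∨ v = b ∨ v = d := by
  classical
  have h1 : (((G.neighborFinset c).erase a).erase b).card = 1 := by
    rw [Finset.card_erase_of_mem (by simp [hab.symm, hcb]), Finset.card_erase_of_mem (by simp [hca]),
      SimpleGraph.card_neighborFinset_eq_degree, hd]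
  obtain ⟨d, hd'⟩ := Finset.card_eq_one.1 h1
  refine ⟨d, fun v hv => ?_⟩
  by_cases hva : v = a
  · exact Or.inl hva
  by_cases hvb : v = b
  · exact Or.inr (Or.inl hvb)
  have : v ∈ ((G.neighborFinset c).erase a).erase b := by simp [hva, hvb, hv]
  rw [hd', Finset.mem_singleton] at this
  exact Or.inr (Or.inr this)

end interface

end ClawFreePacking

theorem mainTheorem6 {V : Type*} [Fintype V] (G : SimpleGraph V) [DecidableRel G.Adj]
    (hclaw : ClawFreePacking.IsClawFree G) (hmod : Fintype.card V ≡ 0 [MOD 3]) :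
    (ClawFreePacking.IsKConnected G 3 →
      ∀ (L : G.Subgraph) (c : V), ClawFreePacking.IsThreePathWithCenter L c → G.degree c = 3 →
        (ClawFreePacking.minus G L).Connected ∧
          ClawFreePacking.HasFactor ClawFreePacking.Lam (ClawFreePacking.minus G L)) ∧
    ((G.IsRegularOfDegree 3 ∧ ClawFreePacking.IsKConnected G 3) ∨
        ClawFreePacking.IsKConnected G 4 →
      ∀ L : G.Subgraph, ClawFreePacking.IsThreePath L →
        (ClawFreePacking.minus G L).Connected ∧
          ClawFreePacking.HasFactor ClawFreePacking.Lam (ClawFreePacking.minus G L)) := by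
  classical
  have h1 : ClawFreePacking.IsKConnected G 3 →
      ∀ (L : G.Subgraph) (c : V), ClawFreePacking.IsThreePathWithCenter L c → G.degree c = 3 →
        (ClawFreePacking.minus G L).Connected ∧
          ClawFreePacking.HasFactor ClawFreePacking.Lam (ClawFreePacking.minus G L) := by
    intro h L c hL hd
    obtain ⟨a, b, hac, hcb, hab, hv⟩ := hL.exists_verts
    obtain ⟨d, hd'⟩ := ClawFreePacking.exists_third_of_degree_eq_three hd hac.symm hcb hab
    exact ClawFreePacking.connected_and_hasFactor_of_chain hclaw hmod h.1 hac.ne hcb.ne hab hv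
      (h.noSep.chain_sdiff_path hclaw hd')
  refine ⟨h1, ?_⟩
  rintro (⟨hreg, h⟩ | h) L ⟨f⟩
  · exact h1 h L _ ⟨f, rfl⟩ (hreg _)
  · obtain ⟨a, b, hac, hcb, hab, hv⟩ :=
      ClawFreePacking.IsThreePathWithCenter.exists_verts (L := L) ⟨f, rfl⟩
    refine ClawFreePacking.connected_and_hasFactor_of_chain hclaw hmod (by have := h.1; omega)
      hac.ne hcb.ne hab hv (ClawFreePacking.NoSep.chain_sdiff hclaw (by simp) ?_)
    rw [Finset.card_eq_three.2 ⟨a, _, b, hac.ne, hab, hcb.ne, rfl⟩]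
    exact h.noSep
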